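/- Setting. Ranked alphabets are finite. $T_\Sigma$ is the set of trees over $\Sigma$ and $T_\Delta(Y_m)$ the set of trees over $\Delta$ with additional leaves from $Y_m=\{y_1,\dots,y_m\}$. A macro tree transducer with look-ahead (MTT) $M=(Q,P,\Sigma,\Delta,q_0,R,h)$ is total and deterministic: $Q$ is a ranked alphabet of states, $q_0\in Q$ has rank $0$, $(P,\Sigma,h)$ is a finite deterministic bottom-up tree automaton with $h:T_\Sigma\to P$ and $L_p=\{s\mid h(s)=p\}$, and for each $q\in Q^{(m)}$, $\sigma\in\Sigma^{(k)}$ and $p_1,\dots,p_k\in P$ there is exactly one right-hand side $\mathrm{rhs}_M(q,\sigma,\langle p_1,\dots,p_k\rangle)\in T_{\Delta\cup\langle Q,X_k\rangle}(Y_m)$, where $\langle q,x_i\rangle$ has the rank of $q$. $M_q(s)\in T_\Delta(Y_m)$ is the $q$-translation of $s$, given by $M_q(\sigma(s_1,\dots,s_k))=\mathrm{rhs}_M(q,\sigma,\langle h(s_1),\dots,h(s_k)\rangle)[\![\langle r,x_i\rangle\leftarrow M_r(s_i)]\!]$, and $M(s)=M_{q_0}(s)$. $M$ is nondeleting if every right-hand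 side for a state of rank $m$ contains all of $y_1,\dots,y_m$. For a set $Y'$ of parameters, $\mathrm{lcop}_{Y'}(t)$ is $t$ with every maximal subtree without a parameter of $Y'$ replaced by a leaf $\$$. For a parameter $y$ of $q$ let $\mathrm{pout}((q,y),p)=\{\mathrm{lcop}_{\{y\}}(M_q(s))\mid s\in L_p\}$; $F_p(q)$ is the set of the parameters $y$ of $q$ for which this set is finite, and $F^1_p=\{q\mid F_p(q)\neq\emptyset\}$. For $r\in F^1_p$ and $h(s)=p$ let $\varphi_s(r)$ be $\mathrm{lcop}_{F_p(r)}(M_r(s))$ with each leaf $\$$ labelled instead by the set $A$ of the parameters that occur in the subtree it replaces. Let $\hat M$ be the MTT that extends $M$ to inputs with additional leaves $p\in P$ (of look-ahead state $p$), with rules $\langle q,p\rangle(y_1,\dots,y_m)\to\langle q,p\rangle(y_1,\dots,y_m)$, the symbols $\langle q,p\rangle$ on the right being new output symbols. The state call $\langle q,p\rangle$ is reachable if it occurs in $\hat M(s)$ for some $s\in T_\Sigma(P)$. $M$ is depth-proper if $\mathrm{pout}((q,y),p)$ is infinite (equivalently, $y$ occurs in the trees $M_q(s)$, $s\in L_p$,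 at unboundedly many depths) for every reachable $\langle q,p\rangle$ and every parameter $y$ of $q$. Construction. $\pi(M)$ has the same alphabets and initial state as $M$. Its look-ahead states are the pairs $(h(s),\varphi_s)$, $s\in T_\Sigma$. Its states are those of $M$ and helper states $(p,r,t,u)$ of rank $|A|$, where $r\in F^1_p$, $t=\varphi_s(r)$ for some $s\in L_p$, and the leaf of $t$ at node $u$ is labelled by the set of parameters $A$. Given $\sigma$ and look-ahead states $(p_1,\varphi_1),\dots,(p_k,\varphi_k)$, let $\zeta_q=\mathrm{rhs}_M(q,\sigma,\langle p_1,\dots,p_k\rangle)$, and let $\Theta$ be the second-order substitution that replaces each $\langle r,x_i\rangle$ with $r\in F^1_{p_i}$ by the tree $t=\varphi_i(r)$ in which the leaf at each node $u$ labelled by a set $A$ is replaced by $\langle (p_i,r,t,u),x_i\rangle(y_j,\ j\in A)$ (with $j$ in increasing order). The look-ahead transition leads to $(p,\varphi)$ with $p=h_\sigma(p_1,\dots,p_k)$ and, for $q\in F^1_p$, $\varphi(q)=\mathrm{lcop}_{F_p(q)}(\zeta_q\Theta)$ with leaves labelled by sets of parameters as above. For $q\in Q$ the right-hand side in $\pi(M)$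 is $\zeta_q\Theta$. For a helper state $(p,r,t,u)$ it is the subtree of $\zeta_r\Theta$ at $u$, with the parameters in $A$ renumbered in increasing order, if the transition leads to $(p,\varphi)$ with $\varphi(r)=t$, and a fixed output tree containing all $|A|$ parameters otherwise (such rules are never used by calls occurring in $\pi(M)$). Theorem. Let $M$ be a nondeleting MTT with look-ahead. Then $\pi(M)$ is nondeleting, and $\pi(M)_q(s)=M_q(s)$ for every state $q$ of $M$ and every $s\in T_\Sigma$; hence all iterates satisfy $\pi^n(M)(s)=M(s)$. Moreover the iteration reaches depth-proper normal form after finitely many steps: there is $N$ such that $\pi^n(M)$ is depth-proper for all $n\ge N$. -/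

import Mathlib

universe u

/-- A ranked alphabet: a finite set of symbols, each with a rank. -/
structure RankedAlphabet : Type (u + 1) where
  Sym : Type u
  rank : Sym → ℕ
  finite : Finite Sym

attribute [instance] RankedAlphabet.finite

namespace RankedAlphabet

/-- The disjoint union of two ranked alphabets. -/
abbrev sum (A B : RankedAlphabet.{u}) : RankedAlphabet.{u} where
  Sym := A.Sym ⊕ B.Sym
  rank := Sum.elim A.rank B.rank
  finite := inferInstance

/-- The ranked alphabet `⟨A, X⟩` of the symbols `⟨a, x⟩`, with the rank of `a`. -/
abbrev angle (A : RankedAlphabet.{u}) (X : Type*) [Finite X] : RankedAlphabet where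
  Sym := A.Sym × X
  rank := fun c => A.rank c.1
  finite := inferInstance

/-- A finite set as a ranked alphabet of symbols of rank `0`. -/
abbrev constants (X : Type u) [Finite X] : RankedAlphabet.{u} where
  Sym := X
  rank := fun _ => 0
  finite := inferInstance

end RankedAlphabet

/-- `Term S V` is the set `T_S(V)` of trees over the ranked alphabet `S` indexed by `V`.
In particular `Term S Empty` is `T_S`, and `Term S (Fin m)` is `T_S(Y_m)`, the parameters
`y_1, …, y_m` being `0, …, m - 1`. -/
inductive Term (S : RankedAlphabet.{u}) (V : Type) : Type u
  | var (v : V) : Term S V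
  | node (s : S.Sym) (args : Fin (S.rank s) → Term S V) : Term S V

namespace Term

variable {S S' A B : RankedAlphabet.{u}} {V W : Type}

/-- The tree `s(y_1, …, y_k)`. -/
def atom (s : S.Sym) : Term S (Fin (S.rank s)) := node s var

/-- First-order substitution for the variables. -/
def bind : Term S V → (V → Term S W) → Term S W
  | var v, f => f v
  | node s a, f => node s fun i => (a i).bind f

/-- Second-order substitution: every symbol `s` is replaced by the tree `f s`, in which `y_j`
stands for the `j`-th argument.  Symbols with `f s = s(y_1, …, y_k)` are left as they are. -/
def subst₂ (f : ∀ s : S.Sym, Term S' (Fin (S.rank s))) : Term S V → Term S' V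
  | var v => var v
  | node s a => (f s).bind fun j => (a j).subst₂ f

/-- Second-order substitution for trees over `A ∪ B`: `f` for the symbols of `A` and `g` for
those of `B`. -/
def substSum (f : ∀ a : A.Sym, Term S' (Fin (A.rank a)))
    (g : ∀ b : B.Sym, Term S' (Fin (B.rank b))) (t : Term (A.sum B) V) : Term S' V :=
  subst₂ (S := A.sum B) (fun c =>
    match c with
    | Sum.inl a => f a
    | Sum.inr b => g b) t

/-- The tree `a(y_1, …, y_k)` over `A ∪ B`, for a symbol `a` of `A`. -/
def atomL (a : A.Sym) : Term (A.sum B) (Fin (A.rank a)) := atom (S := A.sum B) (Sum.inl a)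

/-- The tree `b(y_1, …, y_k)` over `A ∪ B`, for a symbol `b` of `B`. -/
def atomR (b : B.Sym) : Term (A.sum B) (Fin (B.rank b)) := atom (S := A.sum B) (Sum.inr b)

/-- The set of the variables (parameters) occurring in a tree. -/
def paras : Term S V → Set V
  | var v => {v}
  | node _ a => ⋃ i, (a i).paras

/-- The symbol `c` labels some node of the tree. -/
def Occurs (c : S.Sym) : Term S V → Prop
  | var _ => False
  | node s a => s = c ∨ ∃ i, (a i).Occurs c

/-- The subtree at a path, if the path is a node of the tree. Children are numbered from `0`. -/
def sub? : Term S V → List ℕ → Option (Term S V)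
  | t, [] => some t
  | var _, _ :: _ => none
  | node s a, i :: u => if h : i < S.rank s then (a ⟨i, h⟩).sub? u else none

/-- A tree over `A` as a tree over `A ∪ B`, where the leaf `v` at path `u` is replaced by
the tree `f u v`. -/
def replaceLeaves : (t : Term A V) →
    (∀ (u : List ℕ) (v : V), t.sub? u = some (var v) → Term (A.sum B) W) → Term (A.sum B) W
  | var v, f => f [] v rfl
  | node s a, f => node (S := A.sum B) (Sum.inl s) fun i =>
      (a i).replaceLeaves fun u v h => f (i.1 :: u) v (by
        have hi : i.1 < A.rank s := i.2
        rw [sub?, dif_pos hi]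
        exact h)

open Classical in
/-- A tree over `A ∪ B` as a tree over `A`, if no symbol of `B` occurs in it. -/
noncomputable def left? : Term (A.sum B) V → Option (Term A V)
  | var v => some (var v)
  | node (Sum.inl s) a =>
      if h : ∀ i, (a i).left?.isSome then some (node s fun i => (a i).left?.get (h i)) else none
  | node (Sum.inr _) _ => none

open Classical in
/-- The least common output form with parameters: every maximal subtree without a parameter of
`Y'` is replaced by the leaf `$`, which is `none`. -/
noncomputable def lcop (Y' : Set V) : Term S V → Term S (Option V)
  | var y => if y ∈ Y' then var (some y) else var none
  | node s a =>
      if ((node s a).paras ∩ Y').Nonempty then node s fun i => (a i).lcop Y' else var none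

open Classical in
/-- The set of the parameters occurring in a tree, as a `Finset`. -/
noncomputable def parasF {m : ℕ} (t : Term S (Fin m)) : Finset (Fin m) :=
  Finset.univ.filter fun y => y ∈ t.paras

open Classical in
/-- As `lcop`, but in place of `$` the leaf carries the set of the parameters that occur in the
subtree it replaces. -/
noncomputable def lcopF {m : ℕ} (Y' : Set (Fin m)) :
    Term S (Fin m) → Term S (Fin m ⊕ Finset (Fin m))
  | var y => if y ∈ Y' then var (Sum.inl y) else var (Sum.inr {y})
  | node s a =>
      if ((node s a).paras ∩ Y').Nonempty then node s fun i => (a i).lcopF Y'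
      else var (Sum.inr (node s a).parasF)

/-- The height of a tree. -/
noncomputable def height : Term S V → ℕ
  | var _ => 0
  | node _ a => (Finset.univ.sup fun i => (a i).height) + 1

theorem finite_height_le [Finite V] (n : ℕ) : {t : Term S V | t.height ≤ n}.Finite := by
  induction n with
  | zero =>
    refine (Set.finite_range (fun v : V => (var v : Term S V))).subset ?_
    rintro (v | ⟨s, a⟩) h
    · exact ⟨v, rfl⟩
    · simp [height] at h
  | succ n ih =>
    have : Finite {t : Term S V | t.height ≤ n} := ih
    refine ((Set.finite_range (fun v : V => (var v : Term S V))).union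
      (Set.finite_range (fun x : (Σ s : S.Sym, Fin (S.rank s) → {t : Term S V | t.height ≤ n}) =>
        node x.1 fun i => (x.2 i).1))).subset ?_
    rintro (v | ⟨s, a⟩) h
    · exact Or.inl ⟨v, rfl⟩
    · refine Or.inr ⟨⟨s, fun i => ⟨a i, ?_⟩⟩, rfl⟩
      simp only [Set.mem_ofPred_eq, height, Nat.add_le_add_iff_right, Finset.sup_le_iff] at h
      exact h i (Finset.mem_univ i)

theorem height_lcop_of_not (Y' : Set V) (t : Term S V) (h : ¬ (t.paras ∩ Y').Nonempty) :
    (t.lcop Y').height = 0 := by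
  cases t with
  | var y =>
    unfold lcop
    split <;> rfl
  | node s a => simp [lcop, h, height]

theorem height_lcopF_le {m : ℕ} (Y' : Set (Fin m)) (t : Term S (Fin m)) :
    ∀ n, (∀ y ∈ Y', (t.lcop {y}).height ≤ n) → (t.lcopF Y').height ≤ n := by
  induction t with
  | var y =>
    intro n _
    unfold lcopF
    split <;> simp [height]
  | node s a ih =>
    intro n hn
    by_cases hY : ((node s a).paras ∩ Y').Nonempty
    · obtain ⟨y₀, hy₀, hy₀'⟩ := hY
      have hpos : ∀ y ∈ Y', y ∈ (node s a).paras → ∀ i, ((a i).lcop {y}).height + 1 ≤ n := by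
        intro y hy hp i
        have h1 := hn y hy
        have h2 : ((node s a).paras ∩ {y}).Nonempty := ⟨y, hp, rfl⟩
        rw [lcop, if_pos h2, height] at h1
        have h3 := Finset.le_sup (f := fun i => ((a i).lcop {y}).height) (Finset.mem_univ i)
        omega
      rw [lcopF, if_pos ⟨y₀, hy₀, hy₀'⟩, height]
      have h4 : 1 ≤ n := by
        have h1 := hn y₀ hy₀'
        have h2 : ((node s a).paras ∩ {y₀}).Nonempty := ⟨y₀, hy₀, rfl⟩
        rw [lcop, if_pos h2, height] at h1
        omega
      have h5 : (Finset.univ.sup fun i => ((a i).lcopF Y').height) ≤ n - 1 := by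
        refine Finset.sup_le fun i _ => ih i (n - 1) fun y hy => ?_
        by_cases hp : y ∈ (node s a).paras
        · have := hpos y hy hp i
          omega
        · rw [height_lcop_of_not]
          · omega
          · rintro ⟨z, hz, rfl⟩
            exact hp (Set.mem_iUnion.2 ⟨i, hz⟩)
      omega
    · simp [lcopF, hY, height]

theorem finite_paths (t : Term S V) : {u | (t.sub? u).isSome}.Finite := by
  induction t with
  | var v =>
    refine (Set.finite_singleton []).subset ?_
    rintro (_ | ⟨i, u⟩) h
    · rfl
    · simp [sub?] at h
  | node s a ih =>
    refine ((Set.finite_singleton []).union (Set.finite_iUnion fun i : Fin (S.rank s) =>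
      (ih i).image (List.cons i.1))).subset ?_
    rintro (_ | ⟨i, u⟩) h
    · exact Or.inl rfl
    · right
      change ((node s a).sub? (i :: u)).isSome = true at h
      rw [sub?] at h
      split at h
      · rename_i hi
        exact Set.mem_iUnion.2 ⟨⟨i, hi⟩, u, h, rfl⟩
      · simp at h

/-- Where the pruned tree has a leaf labelled `A`, there is a tree whose parameters are those of
`A`. -/
theorem exists_of_sub?_lcopF {m : ℕ} (Y' : Set (Fin m)) (t : Term S (Fin m)) :
    ∀ (u : List ℕ) (A : Finset (Fin m)), (t.lcopF Y').sub? u = some (var (Sum.inr A)) →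
      ∃ d : Term S (Fin m), d.paras = (A : Set (Fin m)) := by
  induction t with
  | var y =>
    intro u A h
    unfold lcopF at h
    split at h <;> cases u <;> simp [sub?] at h
    subst h
    exact ⟨var y, by simp [paras]⟩
  | node s a ih =>
    intro u A h
    unfold lcopF at h
    split at h
    · cases u with
      | nil => simp [sub?] at h
      | cons i u =>
        simp only [sub?] at h
        split at h
        · exact ih _ u A h
        · simp at h
    · cases u with
      | nil =>
        simp only [sub?, Option.some.injEq, var.injEq, Sum.inr.injEq] at h
        exact ⟨node s a, by rw [← h]; simp [parasF]⟩
      | cons i u => simp [sub?] at h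

theorem paras_bind (t : Term S V) (f : V → Term S W) :
    (t.bind f).paras = ⋃ v ∈ t.paras, (f v).paras := by
  induction t with
  | var v => simp [bind, paras]
  | node s a ih =>
    simp only [bind, paras, ih]
    ext w
    simp only [Set.mem_iUnion, exists_prop]
    constructor
    · rintro ⟨i, v, hv, hw⟩
      exact ⟨v, ⟨i, hv⟩, hw⟩
    · rintro ⟨v, ⟨i, hv⟩, hw⟩
      exact ⟨i, v, hv, hw⟩

/-- For a set `A` of `n` parameters, in increasing order `a_1, …, a_n`, replace `a_l` by
`y_l`; `d` is a default tree for parameters outside of `A`. -/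
noncomputable def restrict {m : ℕ} (A : Finset (Fin m)) (d : Term S (Fin A.card))
    (t : Term S (Fin m)) : Term S (Fin A.card) :=
  t.bind fun y => if h : y ∈ A then var ((A.orderIsoOfFin rfl).symm ⟨y, h⟩) else d

theorem exists_paras_eq_univ {m : ℕ} (A : Finset (Fin m)) (t : Term S (Fin m))
    (ht : t.paras = (A : Set (Fin m))) : ∃ d : Term S (Fin A.card), d.paras = Set.univ := by
  have key : ∀ t : Term S (Fin m), t.paras ⊆ (A : Set (Fin m)) →
      ∃ d : Term S (Fin A.card), ∀ l, A.orderEmbOfFin rfl l ∈ t.paras → l ∈ d.paras := by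
    intro t
    induction t with
    | var y =>
      intro h
      have hy : y ∈ A := h rfl
      refine ⟨var ((A.orderIsoOfFin rfl).symm ⟨y, hy⟩), fun l hl => ?_⟩
      have hl' : A.orderEmbOfFin rfl l = y := hl
      have : A.orderIsoOfFin rfl l = ⟨y, hy⟩ := Subtype.ext hl'
      rw [← this]
      simp [paras]
    | node s a ih =>
      intro h
      have h' : ∀ i, (a i).paras ⊆ (A : Set (Fin m)) := fun i y hy =>
        h (Set.mem_iUnion.2 ⟨i, hy⟩)
      choose d hd using fun i => ih i (h' i)
      refine ⟨node s d, fun l hl => ?_⟩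
      obtain ⟨i, hi⟩ := Set.mem_iUnion.1 hl
      exact Set.mem_iUnion.2 ⟨i, hd i l hi⟩
  obtain ⟨d, hd⟩ := key t ht.le
  exact ⟨d, Set.eq_univ_of_forall fun l => hd l (by rw [ht]; exact A.orderEmbOfFin_mem rfl l)⟩

end Term

/-- A total deterministic macro tree transducer with look-ahead, with input alphabet `S` and
output alphabet `D`. -/
structure MTT (S D : RankedAlphabet.{u}) : Type (u + 1) where
  /-- the states -/
  Q : RankedAlphabet.{u}
  /-- the states of the look-ahead automaton -/
  P : Type u
  finiteP : Finite P
  /-- the initial state -/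
  q₀ : Q.Sym
  rank_q₀ : Q.rank q₀ = 0
  /-- the transitions of the look-ahead automaton -/
  h : ∀ σ : S.Sym, (Fin (S.rank σ) → P) → P
  /-- the right-hand sides, in `T_{D ∪ ⟨Q, X_k⟩}(Y_m)` -/
  rhs : ∀ (q : Q.Sym) (σ : S.Sym), (Fin (S.rank σ) → P) →
    Term (D.sum (Q.angle (Fin (S.rank σ)))) (Fin (Q.rank q))

attribute [instance] MTT.finiteP

namespace MTT

variable {S D : RankedAlphabet.{u}} (M : MTT S D)

/-- The state of the look-ahead automaton at the root of an input tree. -/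
def look : Term S Empty → M.P
  | .var e => e.elim
  | .node σ a => M.h σ fun i => look (a i)

/-- `M.sem s q` is the `q`-translation `M_q(s)` of the input tree `s`. -/
def sem : Term S Empty → ∀ q : M.Q.Sym, Term D (Fin (M.Q.rank q))
  | .var e, _ => e.elim
  | .node σ a, q => (M.rhs q σ fun i => M.look (a i)).substSum Term.atom fun c : M.Q.Sym × Fin (S.rank σ) =>
      sem (a c.2) c.1

/-- The translation realized by `M`. -/
def translation (s : Term S Empty) : Term D Empty :=
  (M.sem s M.q₀).bind fun j => (Fin.cast M.rank_q₀ j).elim0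

/-- Every parameter of the state occurs in every right-hand side. -/
def Nondeleting : Prop :=
  ∀ (q : M.Q.Sym) (σ : S.Sym) (p : Fin (S.rank σ) → M.P), (M.rhs q σ p).paras = Set.univ

/-- The extension of `M`, which also processes input leaves labelled by look-ahead states `p`;
the state `q` translates such a leaf to the new output symbol `⟨q, p⟩`. -/
def ext : MTT (S.sum (RankedAlphabet.constants M.P)) (D.sum (M.Q.angle M.P)) where
  Q := M.Q
  P := M.P
  finiteP := M.finiteP
  q₀ := M.q₀
  rank_q₀ := M.rank_q₀
  h := fun σ =>
    match σ with
    | Sum.inl σ => fun p => M.h σ p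
    | Sum.inr p => fun _ => p
  rhs := fun q σ =>
    match σ with
    | Sum.inl σ => fun p => (M.rhs q σ p).substSum
        (fun d => Term.atomL (A := D.sum (M.Q.angle M.P)) (Sum.inl d)) (fun c => Term.atomR c)
    | Sum.inr p => fun _ => Term.atomL (A := D.sum (M.Q.angle M.P)) (Sum.inr (q, p))

/-- The state call `⟨q, p⟩` occurs in the output of the extension of `M` on some input tree. -/
def Reachable (q : M.Q.Sym) (p : M.P) : Prop :=
  ∃ s, (M.ext.translation s).Occurs (Sum.inr (q, p))

/-- The set of the trees `lcop_{Y'}(M_q(s))` for `s` with look-ahead state `p`. -/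
def pout (q : M.Q.Sym) (Y' : Set (Fin (M.Q.rank q))) (p : M.P) :
    Set (Term D (Option (Fin (M.Q.rank q)))) :=
  {t | ∃ s, M.look s = p ∧ (M.sem s q).lcop Y' = t}

/-- `M` is depth-proper: for every reachable state call `⟨q, p⟩` and every parameter `y` of `q`,
the set `pout((q, y), p)` is infinite. -/
def DepthProper : Prop :=
  ∀ q p, M.Reachable q p → ∀ y : Fin (M.Q.rank q), (M.pout q {y} p).Infinite

/-- `F_p(q)`: the depth-bounded parameters of the state call `⟨q, p⟩`. -/
def F (p : M.P) (q : M.Q.Sym) : Set (Fin (M.Q.rank q)) :=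
  {y | (M.pout q {y} p).Finite}

/-- `F¹_p`: the states `q` such that the state call `⟨q, p⟩` is improper. -/
def F₁ (p : M.P) : Set M.Q.Sym := {q | (M.F p q).Nonempty}

/-- Output trees of the state `q` that are pruned by `lcopF`. -/
abbrev Pruned (q : M.Q.Sym) : Type u :=
  Term D (Fin (M.Q.rank q) ⊕ Finset (Fin (M.Q.rank q)))

/-- The pruned output trees of the improper state calls `⟨r, p⟩`, for inputs with look-ahead
state `p`. -/
def poutF (r : M.Q.Sym) (p : M.P) : Set (M.Pruned r) :=
  {t | r ∈ M.F₁ p ∧ ∃ s, M.look s = p ∧ (M.sem s r).lcopF (M.F p r) = t}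

theorem poutF_finite (r : M.Q.Sym) (p : M.P) : (M.poutF r p).Finite := by
  have h : ∀ y : Fin (M.Q.rank r), ∃ n, y ∈ M.F p r →
      ∀ s, M.look s = p → ((M.sem s r).lcop {y}).height ≤ n := by
    intro y
    by_cases hy : y ∈ M.F p r
    · obtain ⟨n, hn⟩ := (Set.Finite.image Term.height hy).bddAbove
      exact ⟨n, fun _ s hs => hn ⟨_, ⟨s, hs, rfl⟩, rfl⟩⟩
    · exact ⟨0, fun h => absurd h hy⟩
  choose n hn using h
  refine (Term.finite_height_le (Finset.univ.sup n)).subset ?_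
  rintro t ⟨-, s, hs, rfl⟩
  exact Term.height_lcopF_le _ _ _ fun y hy =>
    (hn y hy s hs).trans (Finset.le_sup (Finset.mem_univ y))

open Classical in
/-- The mapping `φ` on `F¹_p` (with value `none` outside) that `s` gives rise to:
`φ(q) = lcop_{F_p(q)}(M_q(s))`. -/
noncomputable def phi (p : M.P) (s : Term S Empty) (q : M.Q.Sym) : Option (M.Pruned q) :=
  if q ∈ M.F₁ p then some ((M.sem s q).lcopF (M.F p q)) else none

/-- The look-ahead states `(p, φ)` of `π(M)`, where the values of `φ` are the pruned outputs for
one and the same input tree with look-ahead state `p`. -/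
def PiP : Type u :=
  {x : M.P × (∀ q : M.Q.Sym, Option (M.Pruned q)) // ∃ s, M.look s = x.1 ∧ M.phi x.1 s = x.2}

instance : Finite M.PiP := by
  have hf : ∀ p : M.P, {φ : ∀ q : M.Q.Sym, Option (M.Pruned q) |
      ∃ s, M.look s = p ∧ M.phi p s = φ}.Finite := by
    intro p
    refine (Set.Finite.pi' (t := fun q => insert none (some '' M.poutF q p))
      fun q => ((M.poutF_finite q p).image some).insert none).subset ?_
    rintro φ ⟨s, hs, rfl⟩ q
    unfold phi
    split
    · rename_i hq
      exact Or.inr ⟨_, ⟨hq, s, hs, rfl⟩, rfl⟩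
    · exact Or.inl rfl
  have h := Set.finite_iUnion fun p : M.P => (hf p).image (Prod.mk p)
  refine (h.subset (t := {x : M.P × (∀ q : M.Q.Sym, Option (M.Pruned q)) |
    ∃ s, M.look s = x.1 ∧ M.phi x.1 s = x.2}) ?_).to_subtype
  rintro ⟨p, φ⟩ hx
  exact Set.mem_iUnion.2 ⟨p, φ, hx, rfl⟩

/-- The helper states `(p, r, t, u)` of `π(M)`, where the pruned tree `t` has at path `u` a leaf
labelled with the set `A` of parameters. The state computes the branch that is missing at `u`;
its parameters are those of `A`. -/
structure Helper : Type u where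
  p : M.P
  r : M.Q.Sym
  t : M.Pruned r
  u : List ℕ
  A : Finset (Fin (M.Q.rank r))
  mem : t ∈ M.poutF r p
  leaf : t.sub? u = some (.var (Sum.inr A))

instance : Finite M.Helper := by
  have h1 : ∀ r p, Finite (M.poutF r p) := fun r p => M.poutF_finite r p
  have h2 : ∀ r (t : M.Pruned r), Finite {u | (t.sub? u).isSome} := fun r t => t.finite_paths
  let f : M.Helper → Σ (r : M.Q.Sym) (p : M.P) (t : M.poutF r p),
      {u | (t.1.sub? u).isSome} := fun x =>
    ⟨x.r, x.p, ⟨x.t, x.mem⟩, ⟨x.u, by simp [x.leaf]⟩⟩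
  refine Finite.of_injective f ?_
  rintro ⟨p, r, t, u, A, hm, hl⟩ ⟨p', r', t', u', A', hm', hl'⟩ h
  have hr : r = r' := congrArg Sigma.fst h
  subst hr
  have h := eq_of_heq (Sigma.mk.inj h).2
  have hp : p = p' := congrArg Sigma.fst h
  subst hp
  have h := eq_of_heq (Sigma.mk.inj h).2
  have ht : t = t' := congrArg (fun x => x.1.1) h
  subst ht
  have h := eq_of_heq (Sigma.mk.inj h).2
  have hu : u = u' := congrArg Subtype.val h
  subst hu
  have hA : A = A' := by
    rw [hl] at hl'
    simpa using hl'
  subst hA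
  rfl

/-- The states of `π(M)`: those of `M` and the helper states. -/
abbrev piQ : RankedAlphabet.{u} where
  Sym := M.Q.Sym ⊕ M.Helper
  rank := Sum.elim M.Q.rank fun x => x.A.card
  finite := inferInstance

theorem mem_poutF_of_eq_some {M : MTT S D} (x : M.PiP) {r : M.Q.Sym} {t : M.Pruned r}
    (h : x.1.2 r = some t) : t ∈ M.poutF r x.1.1 := by
  obtain ⟨s, hs, hφ⟩ := x.2
  rw [← hφ, phi] at h
  split at h
  · rename_i hr
    exact ⟨hr, s, hs, by simpa using h⟩
  · simp at h

/-- The tree by which a call `⟨r, x_i⟩` is replaced when the look-ahead state at `x_i` is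
`x = (p, φ)`: if `r ∈ F¹_p`, it is `t = φ(r)`, where a leaf of `t` labelled `A` at path `u` is
replaced by the call `⟨(p, r, t, u), x_i⟩(y_j, j ∈ A)`; otherwise the call is kept. -/
noncomputable def thetaCall {k : ℕ} (i : Fin k) (x : M.PiP) (r : M.Q.Sym) :
    Term (D.sum (M.piQ.angle (Fin k))) (Fin (M.Q.rank r)) :=
  match h : x.1.2 r with
  | none => Term.atomR (B := M.piQ.angle (Fin k)) (Sum.inl r, i)
  | some t => t.replaceLeaves fun u v hv =>
      match v, hv with
      | Sum.inl y, _ => .var y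
      | Sum.inr A, hv =>
          .node (S := D.sum (M.piQ.angle (Fin k)))
            (Sum.inr (Sum.inr ⟨x.1.1, r, t, u, A, mem_poutF_of_eq_some x h, hv⟩, i))
            fun l => .var (A.orderEmbOfFin rfl l)

/-- The tree `ζΘ` for `ζ = rhs_M(q, σ, ⟨p_1, …, p_k⟩)`: second-order substitution of the calls
in the right-hand side according to the look-ahead states `(p_i, φ_i)`. -/
noncomputable def theta (q : M.Q.Sym) (σ : S.Sym) (x : Fin (S.rank σ) → M.PiP) :
    Term (D.sum (M.piQ.angle (Fin (S.rank σ)))) (Fin (M.Q.rank q)) :=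
  (M.rhs q σ fun i => (x i).1.1).substSum Term.atomL fun c : M.Q.Sym × Fin (S.rank σ) =>
    M.thetaCall c.2 (x c.2) c.1

open Classical in
/-- The pair `(p, φ)` with `p = h_σ(p_1, …, p_k)` and `φ(q) = lcop_{F_p(q)}(ζ_qΘ)` for
`q ∈ F¹_p`. -/
noncomputable def piHRaw (σ : S.Sym) (x : Fin (S.rank σ) → M.PiP) :
    M.P × (∀ q : M.Q.Sym, Option (M.Pruned q)) :=
  let p := M.h σ fun i => (x i).1.1
  (p, fun q => if q ∈ M.F₁ p then ((M.theta q σ x).lcopF (M.F p q)).left? else none)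

/-- The look-ahead state of `π(M)` reached on the input tree `s`. -/
noncomputable def PiP.of (s : Term S Empty) : M.PiP := ⟨(M.look s, M.phi (M.look s) s), s, rfl, rfl⟩

open Classical in
/-- The transitions of the look-ahead automaton of `π(M)`. For nondeleting `M`, the pair `piHRaw`
always is a look-ahead state of `π(M)`; the second case only makes the function total for the
other transducers. -/
noncomputable def piH (σ : S.Sym) (x : Fin (S.rank σ) → M.PiP) : M.PiP :=
  if h : ∃ s, M.look s = (M.piHRaw σ x).1 ∧ M.phi (M.piHRaw σ x).1 s = (M.piHRaw σ x).2 then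
    ⟨M.piHRaw σ x, h⟩
  else PiP.of M (.node σ fun i => (x i).2.choose)

theorem Helper.exists_dummy {M : MTT S D} (x : M.Helper) :
    ∃ d : Term D (Fin x.A.card), d.paras = Set.univ := by
  obtain ⟨-, s, -, hs⟩ := x.mem
  have hl := x.leaf
  rw [← hs] at hl
  obtain ⟨d, hd⟩ := Term.exists_of_sub?_lcopF _ _ _ _ hl
  exact Term.exists_paras_eq_univ _ d hd

/-- A fixed output tree in which all parameters of the helper state occur. -/
noncomputable def Helper.dummy {M : MTT S D} (x : M.Helper) (k : ℕ) :
    Term (D.sum (M.piQ.angle (Fin k))) (Fin x.A.card) :=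
  x.exists_dummy.choose.subst₂ Term.atomL

open Classical in
/-- The right-hand side for the helper state `(p, r, t, u)`: if the look-ahead state at the
current input node is `(p, φ)` with `φ(r) = t`, it is the subtree of `ζ_rΘ` at path `u`, with its
parameters renumbered. The state is never called at another input node; as the transducer is
total, it has a dummy rule there. -/
noncomputable def helperRhs (y : M.Helper) (σ : S.Sym) (x : Fin (S.rank σ) → M.PiP) :
    Term (D.sum (M.piQ.angle (Fin (S.rank σ)))) (Fin y.A.card) :=
  if (M.piH σ x).1.1 = y.p ∧ (M.piH σ x).1.2 y.r = some y.t then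
    match (M.theta y.r σ x).sub? y.u with
    | some ξ => Term.restrict y.A (y.dummy _) ξ
    | none => y.dummy _
  else y.dummy _

/-- The construction `π`. -/
noncomputable def pi : MTT S D where
  Q := M.piQ
  P := M.PiP
  finiteP := inferInstance
  q₀ := Sum.inl M.q₀
  rank_q₀ := M.rank_q₀
  h := M.piH
  rhs := fun q =>
    match q with
    | Sum.inl q => fun σ x => M.theta q σ x
    | Sum.inr y => fun σ x => M.helperRhs y σ x

end MTT

/-!
Three ideas make `π` correct and the iteration terminate.

*Correctness.* Suppose that a depth-bounded parameter `y` of `⟨q, p⟩` occurs in the `j`-th argument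
of a call in a right-hand side of `q`. Then `y_j` is depth-bounded for that call: changing the one
input subtree that the call reads would otherwise move `y` arbitrarily deep, because a nondeleting
transducer never erases it (`MTT.Nondeleting.mem_F_of_argOcc`). Hence, after inlining, no call has
a depth-bounded parameter of `q` below it (`MTT.Nondeleting.safe_theta`), and pruning an inlined
right-hand side gives the same tree as pruning the output (`Term.Safe.left?_lcopF`). So the
look-ahead of `π(M)` computes `(h(s), φ_s)`, and a helper state `(p, r, t, u)` computes the subtree
of `M_r(s)` at `u` (`MTT.Nondeleting.look_pi`, `MTT.Nondeleting.sem_pi`).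

*The look-ahead stabilizes along branches.* Consider look-ahead states `p_k` of `π^k(M)`, each
refining the one before, and the decreasing sets `C_k` of inputs with look-ahead state `p_k`. On
`C_k`, the translation by any state of `π^k(M)` is constant or is, up to renaming the parameters,
the subtree of `M_q(s)` at a fixed path, for a state `q` of `M` (`MTT.const_or_describes`); thus
the infinitely many helper states are described by paths. Only finitely many paths occur
(`Term.finite_cut`). Indeed, for a fixed path the set of depth-bounded parameters grows with `k`,
so that it becomes stationary and only finitely many subtrees are ever cut off there; each of these
has fewer parameters, as the depth-bounded ones do not occur in it. Therefore, all pruned outputs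
eventually are constant on `C_k`, and `p_k` has only one refinement
(`MTT.eventually_eq_of_parent_eq`).

*Termination.* From then on, proper calls on the branch stay proper, while an improper call is
replaced by calls of helper states of smaller rank. So no improper call is left after finitely many
steps (`MTT.Nondeleting.eventuallyProper_of_branch`). As there are finitely many look-ahead states
at each stage, König's lemma yields a bound for all branches (`MTT.Nondeleting.eventuallyProper`).
For this argument, the reachable calls are replaced by a larger set that is defined by recursion
along the iteration (`MTT.Live`).
-/

namespace Term

variable {S S' A B : RankedAlphabet.{u}} {V W X : Type}

/-! ### Substitution and parameters -/

theorem bind_var (t : Term S V) : t.bind var = t := by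
  induction t with
  | var v => rfl
  | node s a ih => simp only [bind, ih]

theorem bind_bind (t : Term S V) (f : V → Term S W) (g : W → Term S X) :
    (t.bind f).bind g = t.bind fun v => (f v).bind g := by
  induction t with
  | var v => rfl
  | node s a ih => simp only [bind, ih]

theorem bind_congr {t : Term S V} {f g : V → Term S W} (h : ∀ v ∈ t.paras, f v = g v) :
    t.bind f = t.bind g := by
  induction t with
  | var v => exact h v rfl
  | node s a ih =>
    simp only [bind]
    congr 1
    funext i
    exact ih i fun v hv => h v (Set.mem_iUnion.2 ⟨i, hv⟩)

theorem subst₂_bind (f : ∀ s : S.Sym, Term S' (Fin (S.rank s))) (t : Term S V)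
    (g : V → Term S W) :
    (t.bind g).subst₂ f = (t.subst₂ f).bind fun v => (g v).subst₂ f := by
  induction t with
  | var v => rfl
  | node s a ih => simp only [bind, subst₂, ih, bind_bind]

theorem subst₂_atom (f : ∀ s : S.Sym, Term S' (Fin (S.rank s))) (s : S.Sym) :
    (atom s).subst₂ f = f s := by
  simp only [atom, subst₂, bind_var]

theorem subst₂_subst₂ {S'' : RankedAlphabet.{u}} (f : ∀ s : S.Sym, Term S' (Fin (S.rank s)))
    (g : ∀ s : S'.Sym, Term S'' (Fin (S'.rank s))) (t : Term S V) :
    (t.subst₂ f).subst₂ g = t.subst₂ fun s => (f s).subst₂ g := by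
  induction t with
  | var v => rfl
  | node s a ih => simp only [subst₂, subst₂_bind, ih]

theorem subst₂_id (t : Term S V) : t.subst₂ atom = t := by
  induction t with
  | var v => rfl
  | node s a ih => simp only [subst₂, atom, bind, ih]

theorem paras_subst₂_subset (f : ∀ s : S.Sym, Term S' (Fin (S.rank s))) (t : Term S V) :
    (t.subst₂ f).paras ⊆ t.paras := by
  induction t with
  | var v => exact subset_rfl
  | node s a ih =>
    simp only [subst₂, paras_bind, paras]
    exact Set.iUnion₂_subset fun j _ => (ih j).trans (Set.subset_iUnion (fun i => (a i).paras) j)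

theorem paras_subst₂ {f : ∀ s : S.Sym, Term S' (Fin (S.rank s))}
    (hf : ∀ s, (f s).paras = Set.univ) (t : Term S V) : (t.subst₂ f).paras = t.paras := by
  induction t with
  | var v => rfl
  | node s a ih => simp only [subst₂, paras_bind, paras, hf, ih, Set.mem_univ, Set.iUnion_true]

theorem paras_atom (s : S.Sym) : (atom s).paras = Set.univ := by
  simp [atom, paras, Set.eq_univ_iff_forall]

@[simp]
theorem mem_parasF {m : ℕ} {t : Term S (Fin m)} {y : Fin m} : y ∈ t.parasF ↔ y ∈ t.paras := by
  simp [parasF]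

theorem coe_parasF {m : ℕ} (t : Term S (Fin m)) : (t.parasF : Set (Fin m)) = t.paras := by
  ext; simp

theorem Occurs.bind {c : S.Sym} {t : Term S V} {f : V → Term S W} (h : (t.bind f).Occurs c) :
    t.Occurs c ∨ ∃ v, (f v).Occurs c := by
  induction t with
  | var v => exact Or.inr ⟨v, h⟩
  | node s a ih =>
    rcases h with h | ⟨i, h⟩
    · exact Or.inl (Or.inl h)
    · exact (ih i h).imp (fun h => Or.inr ⟨i, h⟩) id

theorem Occurs.subst₂ {c : S'.Sym} {t : Term S V} {f : ∀ s : S.Sym, Term S' (Fin (S.rank s))}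
    (h : (t.subst₂ f).Occurs c) : ∃ s, t.Occurs s ∧ (f s).Occurs c := by
  induction t with
  | var v => exact h.elim
  | node s a ih =>
    rcases h.bind with h | ⟨j, h⟩
    · exact ⟨s, Or.inl rfl, h⟩
    · obtain ⟨s', h1, h2⟩ := ih j h
      exact ⟨s', Or.inr ⟨j, h1⟩, h2⟩

theorem Occurs.of_sub? {c : S.Sym} {t ξ : Term S V} {u : List ℕ} (h : t.sub? u = some ξ)
    (hc : ξ.Occurs c) : t.Occurs c := by
  induction u generalizing t with
  | nil =>
    simp only [sub?, Option.some.injEq] at h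
    exact h ▸ hc
  | cons i u ih =>
    cases t with
    | var v => simp [sub?] at h
    | node s a =>
      simp only [sub?] at h
      split at h
      · exact Or.inr ⟨_, ih h⟩
      · simp at h

/-! ### Renaming of variables -/

/-- Renaming of variables. -/
def map (f : V → W) (t : Term S V) : Term S W := t.bind fun v => var (f v)

@[simp]
theorem map_var (f : V → W) (v : V) : (var v : Term S V).map f = var (f v) := rfl

@[simp]
theorem map_node (f : V → W) (s : S.Sym) (a : Fin (S.rank s) → Term S V) :
    (node s a).map f = node s fun i => (a i).map f := rfl

theorem map_map (f : V → W) (g : W → X) (t : Term S V) : (t.map f).map g = t.map (g ∘ f) :=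
  bind_bind _ _ _

theorem map_injective {f : V → W} (hf : Function.Injective f) :
    Function.Injective (map f : Term S V → Term S W) := by
  intro t
  induction t with
  | var v =>
    rintro (w | ⟨s, a⟩) h
    · simpa using hf (by simpa using h)
    · simp at h
  | node s a ih =>
    rintro (w | ⟨s', a'⟩) h
    · simp at h
    · simp only [map_node, node.injEq] at h
      obtain ⟨rfl, h⟩ := h
      congr 1
      funext i
      exact ih i (congrFun (eq_of_heq h) i)

theorem paras_map (f : V → W) (t : Term S V) : (t.map f).paras = f '' t.paras := by
  rw [map, paras_bind]
  ext w
  simp [paras, eq_comm]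

theorem sub?_nil (t : Term S V) : t.sub? [] = some t := by rw [sub?]

theorem sub?_map (f : V → W) (t : Term S V) (u : List ℕ) :
    (t.map f).sub? u = (t.sub? u).map (map f) := by
  induction u generalizing t with
  | nil => simp [sub?]
  | cons i u ih =>
    cases t with
    | var v => simp [sub?]
    | node s a =>
      simp only [map_node, sub?]
      split
      · exact ih _
      · rfl

theorem sub?_append (t : Term S V) (u v : List ℕ) :
    t.sub? (u ++ v) = (t.sub? u).bind fun ξ => ξ.sub? v := by
  induction u generalizing t with
  | nil => simp [sub?]
  | cons i u ih =>
    cases t with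
    | var w => simp [sub?]
    | node s a =>
      simp only [List.cons_append, sub?]
      split
      · exact ih _
      · rfl

theorem paras_sub?_subset {t ξ : Term S V} {u : List ℕ} (h : t.sub? u = some ξ) :
    ξ.paras ⊆ t.paras := by
  induction u generalizing t with
  | nil =>
    simp only [sub?, Option.some.injEq] at h
    rw [h]
  | cons i u ih =>
    cases t with
    | var v => simp [sub?] at h
    | node s a =>
      simp only [sub?] at h
      split at h
      · exact (ih h).trans (Set.subset_iUnion (fun i => (a i).paras) _)
      · simp at h

/-- Renumbering the parameters in `A` and naming them as before. -/
theorem restrict_bind {m : ℕ} {A : Finset (Fin m)} {d : Term S (Fin A.card)} {t : Term S (Fin m)}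
    (ht : t.paras ⊆ A) (f : Fin m → Term S W) :
    (restrict A d t).bind (fun l => f (A.orderEmbOfFin rfl l)) = t.bind f := by
  rw [restrict, bind_bind]
  refine bind_congr fun y hy => ?_
  rw [dif_pos (show y ∈ A from ht hy)]
  have : A.orderEmbOfFin rfl ((A.orderIsoOfFin rfl).symm ⟨y, ht hy⟩) = y := by
    rw [← Finset.coe_orderIsoOfFin_apply, OrderIso.apply_symm_apply]
  rw [bind, this]

theorem restrict_map {m : ℕ} {A : Finset (Fin m)} {d : Term S (Fin A.card)} {t : Term S (Fin m)}
    (ht : t.paras ⊆ A) : (restrict A d t).map (A.orderEmbOfFin rfl) = t :=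
  (restrict_bind ht var).trans (bind_var t)

theorem paras_restrict {m : ℕ} {A : Finset (Fin m)} {d : Term S (Fin A.card)} {t : Term S (Fin m)}
    (ht : t.paras = A) : (restrict A d t).paras = Set.univ := by
  refine Set.eq_univ_of_forall fun l => ?_
  have h : A.orderEmbOfFin rfl l ∈ ((restrict A d t).map (A.orderEmbOfFin rfl)).paras := by
    rw [restrict_map ht.le, ht]
    exact A.orderEmbOfFin_mem rfl l
  rw [paras_map] at h
  obtain ⟨l', h, e⟩ := h
  rwa [(A.orderEmbOfFin rfl).injective e] at h

theorem subst₂_restrict {m : ℕ} (f : ∀ s : S.Sym, Term S' (Fin (S.rank s))) (A : Finset (Fin m))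
    (d : Term S (Fin A.card)) (t : Term S (Fin m)) :
    (restrict A d t).subst₂ f = restrict A (d.subst₂ f) (t.subst₂ f) := by
  rw [restrict, subst₂_bind]
  unfold restrict
  congr 1
  funext y
  split <;> rfl

/-! ### Pruned trees -/

section lcopF

variable {m : ℕ} {F : Set (Fin m)}

theorem lcopF_of_not {t : Term S (Fin m)} (h : ¬ (t.paras ∩ F).Nonempty) :
    t.lcopF F = var (Sum.inr t.parasF) := by
  cases t with
  | var y =>
    have hy : y ∉ F := fun hy => h ⟨y, rfl, hy⟩
    rw [lcopF, if_neg hy]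
    congr 2
    ext z
    simp [paras]
  | node s a => rw [lcopF, if_neg h]

theorem lcopF_node_of {s : S.Sym} {a : Fin (S.rank s) → Term S (Fin m)}
    (h : ((node s a).paras ∩ F).Nonempty) :
    (node s a).lcopF F = node s fun i => (a i).lcopF F := by
  rw [lcopF, if_pos h]

/-- The tree that a leaf of the pruned tree replaces. -/
theorem sub?_of_sub?_lcopF {t : Term S (Fin m)} {u : List ℕ} {A : Finset (Fin m)}
    (h : (t.lcopF F).sub? u = some (var (Sum.inr A))) :
    ∃ ξ, t.sub? u = some ξ ∧ ξ.paras = A ∧ Disjoint (A : Set (Fin m)) F := by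
  induction t generalizing u with
  | var y =>
    unfold lcopF at h
    split at h
    · cases u <;> simp [sub?] at h
    · rename_i hy
      cases u <;> simp [sub?] at h
      subst h
      exact ⟨_, rfl, by simp [paras], by simpa using hy⟩
  | node s a ih =>
    by_cases hF : ((node s a).paras ∩ F).Nonempty
    · rw [lcopF_node_of hF] at h
      cases u with
      | nil => simp [sub?] at h
      | cons i u =>
        simp only [sub?] at h ⊢
        split at h
        · rename_i hi
          rw [dif_pos hi]
          exact ih _ h
        · simp at h
    · rw [lcopF_of_not hF] at h
      cases u with
      | nil =>
        simp only [sub?, Option.some.injEq, var.injEq, Sum.inr.injEq] at h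
        refine ⟨_, rfl, by rw [← h, coe_parasF], ?_⟩
        rw [← h, coe_parasF, Set.disjoint_iff_inter_eq_empty]
        exact Set.not_nonempty_iff_eq_empty.1 hF
      | cons i u => simp [sub?] at h

theorem sub?_of_sub?_lcopF_inl {t : Term S (Fin m)} {u : List ℕ} {y : Fin m}
    (h : (t.lcopF F).sub? u = some (var (Sum.inl y))) : t.sub? u = some (var y) := by
  induction t generalizing u with
  | var z =>
    unfold lcopF at h
    split at h <;> cases u <;> simp [sub?] at h
    subst h
    rfl
  | node s a ih =>
    by_cases hF : ((node s a).paras ∩ F).Nonempty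
    · rw [lcopF_node_of hF] at h
      cases u with
      | nil => simp [sub?] at h
      | cons i u =>
        simp only [sub?] at h ⊢
        split at h
        · rename_i hi
          rw [dif_pos hi]
          exact ih _ h
        · simp at h
    · rw [lcopF_of_not hF] at h
      cases u <;> simp [sub?] at h

/-- Pruning commutes with injective renamings of the parameters. -/
theorem lcopF_map {n : ℕ} {ι : Fin n → Fin m} (hι : Function.Injective ι) (t : Term S (Fin n)) :
    (t.map ι).lcopF F = (t.lcopF (ι ⁻¹' F)).map (Sum.map ι (Finset.map ⟨ι, hι⟩)) := by
  have key : ∀ t : Term S (Fin n),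
      ((t.map ι).paras ∩ F).Nonempty ↔ (t.paras ∩ ι ⁻¹' F).Nonempty := by
    intro t
    rw [paras_map, Set.image_inter_nonempty_iff]
  have key₂ : ∀ t : Term S (Fin n), ¬ (t.paras ∩ ι ⁻¹' F).Nonempty →
      (t.map ι).lcopF F = (t.lcopF (ι ⁻¹' F)).map (Sum.map ι (Finset.map ⟨ι, hι⟩)) := by
    intro t ht
    rw [lcopF_of_not ht, lcopF_of_not (mt (key t).1 ht)]
    simp only [map_var, Sum.map_inr]
    congr 2
    ext y
    simp [paras_map]
  induction t with
  | var y =>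
    by_cases hy : ι y ∈ F
    · simp [lcopF, hy]
    · exact key₂ _ fun ⟨z, hz, hz'⟩ => hy (hz ▸ hz')
  | node s a ih =>
    by_cases hF : ((node s a).paras ∩ ι ⁻¹' F).Nonempty
    · have := (key (node s a)).2 hF
      rw [map_node] at this ⊢
      rw [lcopF_node_of hF, lcopF_node_of this, map_node]
      simp only [ih]
    · exact key₂ _ hF

theorem lcop_map {n : ℕ} {ι : Fin n → Fin m} (hι : Function.Injective ι) (y : Fin n)
    (t : Term S (Fin n)) :
    (t.map ι).lcop {ι y} = (t.lcop {y}).map (Option.map ι) := by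
  have key : ∀ t : Term S (Fin n),
      ((t.map ι).paras ∩ {ι y}).Nonempty ↔ (t.paras ∩ {y}).Nonempty := by
    intro t
    rw [paras_map, Set.image_inter_nonempty_iff, ← Set.image_singleton,
      Set.preimage_image_eq _ hι]
  induction t with
  | var z =>
    by_cases hz : z = y
    · simp [lcop, hz]
    · simp [lcop, hz, hι.eq_iff]
  | node s a ih =>
    have := key (node s a)
    rw [map_node] at this ⊢
    unfold lcop
    by_cases hF : ((node s a).paras ∩ {y}).Nonempty
    · rw [if_pos hF, if_pos (this.2 hF), map_node]
      simp only [ih]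
    · rw [if_neg hF, if_neg (mt this.1 hF)]
      rfl

end lcopF

/-! ### The depth of a parameter -/

section depth

/-- The depth of a parameter in a composed tree is at least the depth in the inner part of a
parameter that is replaced by a tree in which it occurs. -/
theorem height_lcop_le_bind_left {y : W} {z : V} (t : Term S V) {f : V → Term S W}
    (hy : y ∈ (f z).paras) : (t.lcop {z}).height ≤ ((t.bind f).lcop {y}).height := by
  induction t with
  | var v =>
    unfold lcop
    split <;> simp [height]
  | node s a ih =>
    by_cases hz : ((node s a).paras ∩ {z}).Nonempty
    · have hy' : (((node s a).bind f).paras ∩ {y}).Nonempty := by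
        refine ⟨y, ?_, rfl⟩
        rw [paras_bind]
        obtain ⟨_, hz, rfl⟩ := hz
        exact Set.mem_iUnion₂.2 ⟨_, hz, hy⟩
      rw [bind] at hy' ⊢
      rw [lcop, if_pos hz, lcop, if_pos hy', height, height]
      exact Nat.succ_le_succ (Finset.sup_mono_fun fun i _ => ih i)
    · rw [height_lcop_of_not _ _ hz]
      exact Nat.zero_le _

/-- The depth of a parameter in a tree is at least its depth in a subtree. -/
theorem height_lcop_le_bind_right {y : W} {z : V} {t : Term S V} (f : V → Term S W)
    (hz : z ∈ t.paras) : ((f z).lcop {y}).height ≤ ((t.bind f).lcop {y}).height := by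
  induction t with
  | var v =>
    cases hz
    exact le_rfl
  | node s a ih =>
    by_cases hy : ((f z).paras ∩ {y}).Nonempty
    · have hy' : (((node s a).bind f).paras ∩ {y}).Nonempty := by
        refine ⟨y, ?_, rfl⟩
        rw [paras_bind]
        obtain ⟨_, hy, rfl⟩ := hy
        exact Set.mem_iUnion₂.2 ⟨_, hz, hy⟩
      obtain ⟨i, hi⟩ := Set.mem_iUnion.1 hz
      rw [bind] at hy' ⊢
      rw [lcop, if_pos hy', height]
      exact ((ih i hi).trans
        (Finset.le_sup (f := fun i => (((a i).bind f).lcop {y}).height) (Finset.mem_univ i))).trans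
          (Nat.le_succ _)
    · rw [height_lcop_of_not _ _ hy]
      exact Nat.zero_le _

/-- The variable `y` occurs in the `j`-th argument of some occurrence of the symbol `c`. -/
inductive ArgOcc (c : S.Sym) (j : Fin (S.rank c)) (y : V) : Term S V → Prop
  | here (a : Fin (S.rank c) → Term S V) : y ∈ (a j).paras → ArgOcc c j y (node c a)
  | there (s : S.Sym) (a : Fin (S.rank s) → Term S V) (i : Fin (S.rank s)) :
      ArgOcc c j y (a i) → ArgOcc c j y (node s a)

theorem ArgOcc.bind {c : S.Sym} {j : Fin (S.rank c)} {y : W} {t : Term S V} {f : V → Term S W}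
    (h : ArgOcc c j y (t.bind f)) :
    (∃ v, ArgOcc c j v t ∧ y ∈ (f v).paras) ∨ ∃ v, ArgOcc c j y (f v) := by
  induction t with
  | var v => exact Or.inr ⟨v, h⟩
  | node s a ih =>
    cases h with
    | here _ h =>
      rw [paras_bind] at h
      obtain ⟨v, hv, h⟩ := Set.mem_iUnion₂.1 h
      exact Or.inl ⟨v, .here _ hv, h⟩
    | there _ _ i h => exact (ih i h).imp (fun ⟨v, h, h'⟩ => ⟨v, .there _ _ i h, h'⟩) id

theorem ArgOcc.subst₂ {b : S'.Sym} {l : Fin (S'.rank b)} {y : V} {t : Term S V}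
    {f : ∀ s : S.Sym, Term S' (Fin (S.rank s))} (h : ArgOcc b l y (t.subst₂ f)) :
    ∃ c j, ArgOcc c j y t ∧ ArgOcc b l j (f c) := by
  induction t with
  | var v => cases h
  | node s a ih =>
    rcases h.bind with ⟨j, h, hy⟩ | ⟨j, h⟩
    · exact ⟨s, j, .here _ (paras_subst₂_subset _ _ hy), h⟩
    · obtain ⟨c, j', h, h'⟩ := ih j h
      exact ⟨c, j', .there _ _ j h, h'⟩

/-- Under a nondeleting substitution, a parameter in the `j`-th argument of a symbol occurs at
least as deep as `y_j` occurs in the tree that replaces the symbol. -/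
theorem ArgOcc.height_le {c : S.Sym} {j : Fin (S.rank c)} {y : V} {t : Term S V}
    (h : ArgOcc c j y t) {f : ∀ s : S.Sym, Term S' (Fin (S.rank s))}
    (hf : ∀ s, (f s).paras = Set.univ) :
    ((f c).lcop {j}).height ≤ ((t.subst₂ f).lcop {y}).height := by
  induction h with
  | here a h =>
    refine height_lcop_le_bind_left _ ?_
    rwa [paras_subst₂ hf]
  | there s a i h ih =>
    refine ih.trans (height_lcop_le_bind_right (fun i => (a i).subst₂ f) (z := i) ?_)
    rw [hf]
    exact Set.mem_univ i

end depth

/-! ### Trees over a union of alphabets -/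

/-- The substitution for the symbols of `A ∪ B` given by `f` on `A` and by `g` on `B`. -/
def sumFun (f : ∀ a : A.Sym, Term S' (Fin (A.rank a))) (g : ∀ b : B.Sym, Term S' (Fin (B.rank b)))
    (c : (A.sum B).Sym) : Term S' (Fin ((A.sum B).rank c)) :=
  match c with
  | Sum.inl a => f a
  | Sum.inr b => g b

theorem substSum_eq (f : ∀ a : A.Sym, Term S' (Fin (A.rank a)))
    (g : ∀ b : B.Sym, Term S' (Fin (B.rank b))) (t : Term (A.sum B) V) :
    t.substSum f g = t.subst₂ (S := A.sum B) (sumFun f g) := rfl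

theorem sumFun_paras {f : ∀ a : A.Sym, Term S' (Fin (A.rank a))}
    {g : ∀ b : B.Sym, Term S' (Fin (B.rank b))} (hf : ∀ a, (f a).paras = Set.univ)
    (hg : ∀ b, (g b).paras = Set.univ) (c : (A.sum B).Sym) :
    (sumFun f g c).paras = Set.univ := by
  cases c with
  | inl a => exact hf a
  | inr b => exact hg b

section outer

variable (g : ∀ b : B.Sym, Term A (Fin (B.rank b)))

theorem substSum_subst₂_atomL (t : Term A V) : (t.subst₂ atomL).substSum atom g = t := by
  rw [substSum_eq, subst₂_subst₂]
  conv_rhs => rw [← subst₂_id t]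
  exact congrArg (fun f => t.subst₂ f) (funext fun s => subst₂_atom (S := A.sum B) _ _)

theorem paras_substSum {g : ∀ b : B.Sym, Term A (Fin (B.rank b))}
    (hg : ∀ b, (g b).paras = Set.univ) (t : Term (A.sum B) V) :
    (t.substSum atom g).paras = t.paras :=
  paras_subst₂ (S := A.sum B) (sumFun_paras paras_atom hg) t

end outer

theorem left?_node_inl {s : A.Sym} {a : Fin (A.rank s) → Term (A.sum B) V}
    {b : Fin (A.rank s) → Term A V} (h : ∀ i, (a i).left? = some (b i)) :
    (node (S := A.sum B) (Sum.inl s) a).left? = some (node s b) := by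
  have h' : ∀ i, (a i).left?.isSome := fun i => by rw [h]; rfl
  refine (dif_pos h').trans ?_
  simp only [h, Option.get_some]

section safe

variable {m : ℕ} {F : Set (Fin m)} {ξ : Term (A.sum B) (Fin m)}
  {g : ∀ b : B.Sym, Term A (Fin (B.rank b))}

/-- No variable of `F` occurs below a symbol of `B`. -/
def Safe (F : Set (Fin m)) (ξ : Term (A.sum B) (Fin m)) : Prop :=
  ∀ (b : B.Sym) (l : Fin (B.rank b)), ∀ y ∈ F,
    ¬ ArgOcc (S := A.sum B) (Sum.inr b) l y ξ

theorem Safe.arg {s : (A.sum B).Sym} {a : Fin ((A.sum B).rank s) → Term (A.sum B) (Fin m)}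
    (h : Safe F (node s a)) (i : Fin ((A.sum B).rank s)) : Safe F (a i) :=
  fun b l y hy h' => h b l y hy (.there s a i h')

theorem Safe.not_nonempty {b : B.Sym} {a : Fin (B.rank b) → Term (A.sum B) (Fin m)}
    (h : Safe F (node (S := A.sum B) (Sum.inr b) a)) :
    ¬ ((node (S := A.sum B) (Sum.inr b) a).paras ∩ F).Nonempty := by
  rintro ⟨y, hy, hF⟩
  obtain ⟨i, hi⟩ := Set.mem_iUnion.1 hy
  exact h b i y hF (ArgOcc.here (S := A.sum B) (c := Sum.inr b) a hi)

/-- If no variable of `F` occurs below a symbol of `B`, then the part of the tree that is kept by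
pruning does not change if the symbols of `B` are replaced. -/
theorem Safe.left?_lcopF (h : Safe F ξ) (hg : ∀ b, (g b).paras = Set.univ) :
    (ξ.lcopF F).left? = some ((ξ.substSum atom g).lcopF F) := by
  have key : ∀ ξ : Term (A.sum B) (Fin m), ¬ (ξ.paras ∩ F).Nonempty →
      (ξ.lcopF F).left? = some ((ξ.substSum atom g).lcopF F) := by
    intro ξ hξ
    rw [lcopF_of_not hξ, lcopF_of_not (by rwa [paras_substSum hg])]
    rw [left?]
    congr 3
    ext y
    simp [paras_substSum hg]
  induction ξ with
  | var y =>
    simp only [substSum, subst₂, lcopF]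
    split <;> rfl
  | node s a ih =>
    by_cases hF : ((node s a).paras ∩ F).Nonempty
    · cases s with
      | inl s =>
        have hF' := hF
        rw [← paras_substSum hg] at hF'
        refine (congrArg left? (lcopF_node_of hF)).trans
          ((left?_node_inl (A := A) (B := B) (s := s) (a := fun i => (a i).lcopF F)
            fun i => ih i (h.arg i)).trans (congrArg some ?_))
        exact (lcopF_node_of (s := s) (a := fun i => (a i).substSum atom g) hF').symm
      | inr b => exact absurd hF h.not_nonempty
    · exact key _ hF

/-- Where pruning cuts off a subtree of the value of a tree, it cuts off the value of a subtree. -/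
theorem Safe.sub?_of_leaf (h : Safe F ξ) (hg : ∀ b, (g b).paras = Set.univ) {u : List ℕ}
    {C : Finset (Fin m)} (hu : ((ξ.substSum atom g).lcopF F).sub? u = some (var (Sum.inr C))) :
    ∃ ξ', ξ.sub? u = some ξ' ∧ (ξ.substSum atom g).sub? u = some (ξ'.substSum atom g) := by
  have key : ∀ (ξ : Term (A.sum B) (Fin m)) (u : List ℕ), ¬ (ξ.paras ∩ F).Nonempty →
      ((ξ.substSum atom g).lcopF F).sub? u = some (var (Sum.inr C)) →
      ∃ ξ', ξ.sub? u = some ξ' ∧ (ξ.substSum atom g).sub? u = some (ξ'.substSum atom g) := by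
    intro ξ u hξ hu
    rw [lcopF_of_not (by rwa [paras_substSum hg])] at hu
    cases u with
    | nil => exact ⟨ξ, sub?_nil _, sub?_nil _⟩
    | cons i u => simp [sub?] at hu
  induction ξ generalizing u with
  | var y =>
    cases u with
    | nil => exact ⟨_, sub?_nil _, sub?_nil _⟩
    | cons i u =>
      simp only [substSum, subst₂, lcopF] at hu
      split at hu <;> simp [sub?] at hu
  | node s a ih =>
    by_cases hF : ((node s a).paras ∩ F).Nonempty
    · cases s with
      | inl s =>
        rw [← paras_substSum hg] at hF
        have hu' : (node s fun i => ((a i).substSum atom g).lcopF F).sub? u =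
          some (var (Sum.inr C)) := (congrArg (sub? · u) (lcopF_node_of hF)).symm.trans hu
        cases u with
        | nil => simp [sub?] at hu'
        | cons i u =>
          by_cases hi : i < A.rank s
          · rw [sub?, dif_pos hi] at hu'
            obtain ⟨ξ', h1, h2⟩ := ih ⟨i, hi⟩ (h.arg _) hu'
            exact ⟨ξ', (dif_pos hi).trans h1, (dif_pos hi).trans h2⟩
          · rw [sub?, dif_neg hi] at hu'
            cases hu'
      | inr b => exact absurd hF h.not_nonempty
    · exact key _ _ hF hu

end safe

/-- If the leaves of a pruned tree are replaced by trees that evaluate to the subtrees that were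
cut off, the result evaluates to the unpruned tree. -/
theorem substSum_replaceLeaves {m : ℕ} {F : Set (Fin m)}
    (g : ∀ b : B.Sym, Term A (Fin (B.rank b))) {t : Term A (Fin m ⊕ Finset (Fin m))}
    {τ : Term A (Fin m)} (ht : t = τ.lcopF F)
    (G : ∀ (u : List ℕ) (v : Fin m ⊕ Finset (Fin m)), t.sub? u = some (var v) →
      Term (A.sum B) (Fin m))
    (hG : ∀ u v hv ξ, τ.sub? u = some ξ → (G u v hv).substSum atom g = ξ) :
    (t.replaceLeaves G).substSum atom g = τ := by
  induction τ generalizing t with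
  | var y =>
    have : ∃ v, t = var v := by
      rw [ht, lcopF]
      split <;> exact ⟨_, rfl⟩
    obtain ⟨v, rfl⟩ := this
    exact hG [] v rfl _ rfl
  | node s a ih =>
    by_cases hF : ((node s a).paras ∩ F).Nonempty
    · rw [lcopF_node_of hF] at ht
      subst ht
      refine congrArg (node s) (funext fun i => ?_)
      refine ih i rfl _ fun u v hv ξ hξ => hG _ _ _ _ ?_
      rw [sub?, dif_pos i.2]
      exact hξ
    · rw [lcopF_of_not hF] at ht
      subst ht
      exact hG [] _ rfl _ rfl

end Term

namespace MTT

open Term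

variable {S D : RankedAlphabet.{u}} {M : MTT S D}

/-! ### Depth-bounded parameters -/

theorem look_node (σ : S.Sym) (a : Fin (S.rank σ) → Term S Empty) :
    M.look (.node σ a) = M.h σ fun i => M.look (a i) := rfl

theorem sem_node (σ : S.Sym) (a : Fin (S.rank σ) → Term S Empty) (q : M.Q.Sym) :
    M.sem (.node σ a) q = (M.rhs q σ fun i => M.look (a i)).substSum Term.atom
      (B := M.Q.angle (Fin (S.rank σ))) fun c => M.sem (a c.2) c.1 := rfl

theorem Nondeleting.paras_sem (hM : M.Nondeleting) (s : Term S Empty) (q : M.Q.Sym) :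
    (M.sem s q).paras = Set.univ := by
  induction s generalizing q with
  | var e => exact e.elim
  | node σ a ih =>
    rw [sem_node, paras_substSum (B := M.Q.angle (Fin (S.rank σ))) fun c => ih c.2 c.1]
    exact hM q σ _

theorem mem_F_iff {p : M.P} {q : M.Q.Sym} {y : Fin (M.Q.rank q)} :
    y ∈ M.F p q ↔ ∃ n, ∀ s, M.look s = p → ((M.sem s q).lcop {y}).height ≤ n := by
  constructor
  · intro hy
    obtain ⟨n, hn⟩ := (Set.Finite.image Term.height hy).bddAbove
    exact ⟨n, fun s hs => hn ⟨_, ⟨s, hs, rfl⟩, rfl⟩⟩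
  · rintro ⟨n, hn⟩
    refine (Term.finite_height_le n).subset ?_
    rintro t ⟨s, hs, rfl⟩
    exact hn s hs

/-- If a depth-bounded parameter of `⟨q, p⟩` occurs in the `j`-th argument of a call in a
right-hand side, then `y_j` is depth-bounded for that call: otherwise one could make it arbitrarily
deep by changing one subtree of the input only. -/
theorem Nondeleting.mem_F_of_argOcc (hM : M.Nondeleting) {q : M.Q.Sym} {σ : S.Sym}
    (a : Fin (S.rank σ) → Term S Empty) {y : Fin (M.Q.rank q)}
    (hy : y ∈ M.F (M.look (.node σ a)) q) {r : M.Q.Sym} {i : Fin (S.rank σ)}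
    {j : Fin (M.Q.rank r)}
    (h : ArgOcc (S := D.sum (M.Q.angle (Fin (S.rank σ)))) (Sum.inr (r, i)) j y
      (M.rhs q σ fun i => M.look (a i))) : j ∈ M.F (M.look (a i)) r := by
  obtain ⟨n, hn⟩ := mem_F_iff.1 hy
  refine mem_F_iff.2 ⟨n, fun s hs => ?_⟩
  -- Replacing the `i`-th subtree by one with the same look-ahead state selects the same rule.
  have hl : (fun i' => M.look (Function.update a i s i')) = fun i' => M.look (a i') := by
    funext i'
    by_cases hi : i' = i
    · subst hi
      rw [Function.update_self, hs]
    · rw [Function.update_of_ne hi]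
  have hn' := hn (.node σ (Function.update a i s)) (by rw [look_node, hl, look_node])
  rw [sem_node, hl] at hn'
  have hle := h.height_le (f := sumFun (B := M.Q.angle (Fin (S.rank σ))) Term.atom
    fun c => M.sem (Function.update a i s c.2) c.1)
    (sumFun_paras (B := M.Q.angle (Fin (S.rank σ))) paras_atom fun c => hM.paras_sem _ _)
  refine le_trans (le_of_eq ?_) (hle.trans hn')
  change ((M.sem s r).lcop {j}).height = ((M.sem (Function.update a i s i) r).lcop {j}).height
  rw [Function.update_self]

theorem phi_of_mem {p : M.P} {s : Term S Empty} {q : M.Q.Sym} (hq : q ∈ M.F₁ p) :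
    M.phi p s q = some ((M.sem s q).lcopF (M.F p q)) := if_pos hq

theorem phi_of_not_mem {p : M.P} {s : Term S Empty} {q : M.Q.Sym} (hq : q ∉ M.F₁ p) :
    M.phi p s q = none := if_neg hq

theorem phi_eq_some {p : M.P} {s : Term S Empty} {q : M.Q.Sym} {t : M.Pruned q}
    (h : M.phi p s q = some t) : q ∈ M.F₁ p ∧ t = (M.sem s q).lcopF (M.F p q) := by
  unfold phi at h
  split at h
  · rename_i hq
    exact ⟨hq, (Option.some.inj h).symm⟩
  · cases h

theorem phi_eq_none {p : M.P} {s : Term S Empty} {q : M.Q.Sym} (h : M.phi p s q = none) :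
    q ∉ M.F₁ p := by
  intro hq
  rw [phi_of_mem hq] at h
  cases h

theorem PiP.exists_of (x : M.PiP) : ∃ s, x = PiP.of M s := by
  obtain ⟨⟨p, φ⟩, s, hs, hφ⟩ := x
  dsimp only at hs hφ
  subst hs hφ
  exact ⟨s, rfl⟩

/-! ### The translations of the states of `π(M)` -/

open Classical in
/-- The translation of a helper state `(p, r, t, u)`: the subtree at `u` of the `r`-translation,
with its parameters renumbered, if the `r`-translation is pruned to `t`; otherwise a dummy
tree. -/
noncomputable def Helper.sem (y : M.Helper) (s : Term S Empty) : Term D (Fin y.A.card) :=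
  if M.look s = y.p ∧ M.phi (M.look s) s y.r = some y.t then
    match (M.sem s y.r).sub? y.u with
    | some ξ => Term.restrict y.A y.exists_dummy.choose ξ
    | none => y.exists_dummy.choose
  else y.exists_dummy.choose

/-- The translations of the states of `π(M)`, described directly in terms of those of `M`. -/
noncomputable def piSem (s : Term S Empty) : ∀ q : M.piQ.Sym, Term D (Fin (M.piQ.rank q))
  | Sum.inl q => M.sem s q
  | Sum.inr y => y.sem s

theorem Helper.exists_sub? (y : M.Helper) {s : Term S Empty}
    (h : M.phi (M.look s) s y.r = some y.t) :
    ∃ ξ, (M.sem s y.r).sub? y.u = some ξ ∧ ξ.paras = (y.A : Set (Fin (M.Q.rank y.r))) ∧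
      Disjoint (y.A : Set (Fin (M.Q.rank y.r))) (M.F (M.look s) y.r) := by
  obtain ⟨-, ht⟩ := phi_eq_some h
  have hl := y.leaf
  rw [ht] at hl
  exact sub?_of_sub?_lcopF hl

theorem Helper.sem_of_pos (y : M.Helper) {s : Term S Empty} (h : M.look s = y.p)
    (h' : M.phi (M.look s) s y.r = some y.t) {ξ : Term D (Fin (M.Q.rank y.r))}
    (hξ : (M.sem s y.r).sub? y.u = some ξ) :
    y.sem s = Term.restrict y.A y.exists_dummy.choose ξ := by
  rw [Helper.sem, if_pos ⟨h, h'⟩, hξ]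

theorem Helper.sem_of_neg (y : M.Helper) {s : Term S Empty}
    (h : ¬ (M.look s = y.p ∧ M.phi (M.look s) s y.r = some y.t)) :
    y.sem s = y.exists_dummy.choose := if_neg h

theorem Helper.paras_sem (y : M.Helper) (s : Term S Empty) : (y.sem s).paras = Set.univ := by
  by_cases h : M.look s = y.p ∧ M.phi (M.look s) s y.r = some y.t
  · obtain ⟨ξ, hξ, hA, -⟩ := y.exists_sub? h.2
    rw [y.sem_of_pos h.1 h.2 hξ]
    exact paras_restrict hA
  · rw [y.sem_of_neg h]
    exact y.exists_dummy.choose_spec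

theorem Nondeleting.paras_piSem (hM : M.Nondeleting) (s : Term S Empty) (q : M.piQ.Sym) :
    (piSem s q).paras = Set.univ := by
  cases q with
  | inl q => exact hM.paras_sem s q
  | inr y => exact y.paras_sem s

section thetaCall

variable {k : ℕ} {i : Fin k} {x : M.PiP} {r : M.Q.Sym}

theorem thetaCall_of_none (h : x.1.2 r = none) :
    M.thetaCall i x r = Term.atomR (B := M.piQ.angle (Fin k)) (Sum.inl r, i) := by
  unfold thetaCall
  split
  · rfl
  · rename_i h'
    rw [h] at h'
    cases h'

theorem thetaCall_of_some {t : M.Pruned r} (h : x.1.2 r = some t) :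
    M.thetaCall i x r = t.replaceLeaves fun u v hv =>
      match v, hv with
      | Sum.inl y, _ => .var y
      | Sum.inr A, hv =>
          .node (S := D.sum (M.piQ.angle (Fin k)))
            (Sum.inr (Sum.inr ⟨x.1.1, r, t, u, A, mem_poutF_of_eq_some x h, hv⟩, i))
            fun l => .var (A.orderEmbOfFin rfl l) := by
  unfold thetaCall
  split
  · rename_i h'
    rw [h] at h'
    cases h'
  · rename_i t' h'
    have : t' = t := Option.some.inj (h'.symm.trans h)
    subst this
    rfl

/-- The inlined pruned tree of a call evaluates to the translation of the called state. -/
theorem substSum_thetaCall (a : Fin k → Term S Empty) (i : Fin k) (r : M.Q.Sym) :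
    (M.thetaCall i (PiP.of M (a i)) r).substSum Term.atom (B := M.piQ.angle (Fin k))
      (fun c => piSem (a c.2) c.1) = M.sem (a i) r := by
  cases h : (PiP.of M (a i)).1.2 r with
  | none =>
    rw [thetaCall_of_none h]
    exact subst₂_atom (S := D.sum (M.piQ.angle (Fin k))) _ _
  | some t =>
    obtain ⟨hr, ht⟩ := phi_eq_some h
    rw [thetaCall_of_some h]
    refine substSum_replaceLeaves (B := M.piQ.angle (Fin k)) _ ht _ fun u v hv ξ hξ => ?_
    rw [ht] at hv
    cases v with
    | inl y =>
      have := sub?_of_sub?_lcopF_inl hv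
      rw [hξ] at this
      cases this
      rfl
    | inr A =>
      obtain ⟨ξ', hξ', hA, -⟩ := sub?_of_sub?_lcopF hv
      rw [hξ] at hξ'
      cases hξ'
      rw [← ht] at hv
      let y : M.Helper := ⟨_, r, t, u, A, mem_poutF_of_eq_some _ h, hv⟩
      change (y.sem (a i)).bind (fun l => var (A.orderEmbOfFin rfl l)) = ξ
      rw [y.sem_of_pos rfl h hξ]
      exact restrict_map hA.le

end thetaCall

/-- The calls of `π(M)` in an inlined call are: the call itself if it is proper, and otherwise
calls of helper states for it. -/
theorem occurs_thetaCall {k : ℕ} {i : Fin k} {x : M.PiP} {r : M.Q.Sym} {g : M.piQ.Sym} {i' : Fin k}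
    (h : (M.thetaCall i x r).Occurs (S := D.sum (M.piQ.angle (Fin k))) (Sum.inr (g, i'))) :
    i' = i ∧ ((g = Sum.inl r ∧ r ∉ M.F₁ x.1.1) ∨
      ∃ y : M.Helper, g = Sum.inr y ∧ y.p = x.1.1 ∧ y.r = r ∧ x.1.2 y.r = some y.t) := by
  obtain ⟨s, rfl⟩ := PiP.exists_of x
  cases hx : (PiP.of M s).1.2 r with
  | none =>
    rw [thetaCall_of_none hx] at h
    rcases h with h | ⟨_, h⟩
    · cases h
      exact ⟨rfl, Or.inl ⟨rfl, phi_eq_none hx⟩⟩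
    · exact h.elim
  | some t =>
    rw [thetaCall_of_some hx] at h
    have key : ∀ (t' : M.Pruned r) (G : ∀ (u : List ℕ) (v : Fin (M.Q.rank r) ⊕ Finset _),
        t'.sub? u = some (var v) → Term (D.sum (M.piQ.angle (Fin k))) (Fin (M.Q.rank r))),
        (t'.replaceLeaves G).Occurs (S := D.sum (M.piQ.angle (Fin k))) (Sum.inr (g, i')) →
        ∃ u v hv, (G u v hv).Occurs (S := D.sum (M.piQ.angle (Fin k))) (Sum.inr (g, i')) := by
      intro t'
      induction t' with
      | var v => exact fun G h => ⟨[], v, rfl, h⟩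
      | node s a ih =>
        intro G h
        rcases h with h | ⟨j, h⟩
        · cases h
        · obtain ⟨u, v, hv, h⟩ := ih j _ h
          exact ⟨_, v, _, h⟩
    obtain ⟨u, v, hv, h⟩ := key _ _ h
    cases v with
    | inl y => exact h.elim
    | inr A =>
      rcases h with h | ⟨_, h⟩
      · cases h
        exact ⟨rfl, Or.inr ⟨_, rfl, rfl, rfl, hx⟩⟩
      · exact h.elim

/-- No call in an inlined call has a depth-bounded parameter in its arguments. -/
theorem not_mem_F_of_argOcc_thetaCall {k : ℕ} {i : Fin k} {x : M.PiP} {r : M.Q.Sym}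
    {b : (M.piQ.angle (Fin k)).Sym} {l : Fin ((M.piQ.angle (Fin k)).rank b)}
    {j : Fin (M.Q.rank r)}
    (h : ArgOcc (S := D.sum (M.piQ.angle (Fin k))) (Sum.inr b) l j (M.thetaCall i x r)) :
    j ∉ M.F x.1.1 r := by
  obtain ⟨s, rfl⟩ := PiP.exists_of x
  cases hx : (PiP.of M s).1.2 r with
  | none => exact fun hj => phi_eq_none hx ⟨j, hj⟩
  | some t =>
    rw [thetaCall_of_some hx] at h
    have key : ∀ (t' : M.Pruned r) (G : ∀ (u : List ℕ) (v : Fin (M.Q.rank r) ⊕ Finset _),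
        t'.sub? u = some (var v) → Term (D.sum (M.piQ.angle (Fin k))) (Fin (M.Q.rank r))),
        ArgOcc (S := D.sum (M.piQ.angle (Fin k))) (Sum.inr b) l j (t'.replaceLeaves G) →
        ∃ u v hv, ArgOcc (S := D.sum (M.piQ.angle (Fin k))) (Sum.inr b) l j (G u v hv) := by
      intro t'
      induction t' with
      | var v => exact fun G h => ⟨[], v, rfl, h⟩
      | node s a ih =>
        intro G h
        rw [replaceLeaves] at h
        cases h with
        | there _ _ i' h =>
          obtain ⟨u, v, hv, h⟩ := ih i' _ h
          exact ⟨_, v, _, h⟩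
    obtain ⟨u, v, hv, h⟩ := key _ _ h
    cases v with
    | inl y => cases h
    | inr A =>
      have hj : j ∈ A := by
        cases h with
        | here _ h =>
          cases h
          exact A.orderEmbOfFin_mem rfl _
        | there _ _ i' h => cases h
      rw [(phi_eq_some hx).2] at hv
      obtain ⟨-, -, -, hd⟩ := sub?_of_sub?_lcopF hv
      exact fun hF => Set.disjoint_left.1 hd hj hF

section theta

variable (σ : S.Sym) (a : Fin (S.rank σ) → Term S Empty) (q : M.Q.Sym)

/-- Inlining does not change the value of a right-hand side. -/
theorem substSum_theta :
    (M.theta q σ fun i => PiP.of M (a i)).substSum Term.atom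
      (B := M.piQ.angle (Fin (S.rank σ))) (fun c => piSem (a c.2) c.1) =
    M.sem (.node σ a) q := by
  rw [theta, sem_node, substSum_eq, substSum_eq, substSum_eq, subst₂_subst₂]
  refine congrArg (fun f => Term.subst₂ f _) (funext fun c => ?_)
  cases c with
  | inl d => exact subst₂_atom (S := D.sum (M.piQ.angle (Fin (S.rank σ)))) _ _
  | inr c => exact substSum_thetaCall a c.2 c.1

/-- After inlining, no call has a depth-bounded parameter in its arguments. -/
theorem Nondeleting.safe_theta (hM : M.Nondeleting) :
    Safe (M.F (M.look (.node σ a)) q) (M.theta q σ fun i => PiP.of M (a i)) := by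
  intro b l y hy h
  rw [theta, substSum_eq] at h
  obtain ⟨c, j, h1, h2⟩ := h.subst₂
  cases c with
  | inl d =>
    cases h2 with
    | there _ _ i h => cases h
  | inr c => exact not_mem_F_of_argOcc_thetaCall h2 (hM.mem_F_of_argOcc a hy h1)

open Classical in
theorem Nondeleting.piHRaw_of (hM : M.Nondeleting) :
    M.piHRaw σ (fun i => PiP.of M (a i)) = (PiP.of M (.node σ a)).1 := by
  refine Prod.ext rfl (funext fun q => ?_)
  change (if q ∈ M.F₁ (M.look (.node σ a)) then
    ((M.theta q σ fun i => PiP.of M (a i)).lcopF (M.F (M.look (.node σ a)) q)).left? else none) =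
      M.phi (M.look (.node σ a)) (.node σ a) q
  by_cases hq : q ∈ M.F₁ (M.look (.node σ a))
  · rw [if_pos hq, phi_of_mem hq, ← substSum_theta]
    exact (hM.safe_theta σ a q).left?_lcopF fun c => hM.paras_piSem _ _
  · rw [if_neg hq, phi_of_not_mem hq]

theorem Nondeleting.piH_of (hM : M.Nondeleting) :
    M.piH σ (fun i => PiP.of M (a i)) = PiP.of M (.node σ a) := by
  have h := hM.piHRaw_of σ a
  exact (dif_pos (by rw [h]; exact (PiP.of M (.node σ a)).2)).trans (Subtype.ext h)

theorem Nondeleting.substSum_helperRhs (hM : M.Nondeleting) (y : M.Helper) :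
    (M.helperRhs y σ fun i => PiP.of M (a i)).substSum Term.atom
      (B := M.piQ.angle (Fin (S.rank σ))) (fun c => piSem (a c.2) c.1) =
    y.sem (.node σ a) := by
  rw [helperRhs, hM.piH_of]
  by_cases h : M.look (.node σ a) = y.p ∧ M.phi (M.look (.node σ a)) (.node σ a) y.r = some y.t
  · rw [if_pos (by exact h)]
    have hl := y.leaf
    rw [(phi_eq_some h.2).2, ← substSum_theta] at hl
    obtain ⟨ξ, h1, h2⟩ :=
      (hM.safe_theta σ a y.r).sub?_of_leaf (fun c => hM.paras_piSem _ _) hl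
    rw [substSum_theta] at h2
    rw [y.sem_of_pos h.1 h.2 h2]
    simp only [h1]
    rw [substSum_eq, subst₂_restrict]
    exact congrArg (fun d => Term.restrict y.A d _) (substSum_subst₂_atomL _ _)
  · rw [if_neg (by exact h), y.sem_of_neg h]
    exact substSum_subst₂_atomL _ _

end theta

/-! ### Correctness of `π(M)` -/

/-- Every family of look-ahead states of `π(M)` arises from input trees, so that the right-hand
sides of `π(M)` evaluate to trees in which all parameters occur. -/
theorem Nondeleting.pi (hM : M.Nondeleting) : M.pi.Nondeleting := by
  intro q σ x
  choose a ha using fun i => PiP.exists_of (x i)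
  have hx : x = fun i => PiP.of M (a i) := funext ha
  subst hx
  have hg : ∀ c : (M.piQ.angle (Fin (S.rank σ))).Sym, (piSem (a c.2) c.1).paras = Set.univ :=
    fun c => hM.paras_piSem _ _
  refine (paras_substSum (B := M.piQ.angle (Fin (S.rank σ))) hg _).symm.trans ?_
  cases q with
  | inl q => exact (congrArg paras (substSum_theta σ a q)).trans (hM.paras_sem _ q)
  | inr y => exact (congrArg paras (hM.substSum_helperRhs σ a y)).trans (y.paras_sem _)

theorem Nondeleting.look_pi (hM : M.Nondeleting) (s : Term S Empty) :
    M.pi.look s = PiP.of M s := by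
  induction s with
  | var e => exact e.elim
  | node σ a ih =>
    rw [look_node, ← hM.piH_of]
    exact congrArg (M.piH σ) (funext ih)

theorem Nondeleting.sem_pi (hM : M.Nondeleting) (s : Term S Empty) (q : M.piQ.Sym) :
    M.pi.sem s q = piSem s q := by
  induction s generalizing q with
  | var e => exact e.elim
  | node σ a ih =>
    have h1 : (fun i => M.pi.look (a i)) = fun i => PiP.of M (a i) :=
      funext fun i => hM.look_pi (a i)
    have h2 : (fun c : (M.piQ.angle (Fin (S.rank σ))).Sym => M.pi.sem (a c.2) c.1) =
      fun c : (M.piQ.angle (Fin (S.rank σ))).Sym => piSem (a c.2) c.1 :=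
    funext fun c => ih c.2 c.1
    refine (sem_node (M := M.pi) σ a q).trans ?_
    refine (congrArg (fun x => (M.pi.rhs q σ x).substSum Term.atom
      (B := M.piQ.angle (Fin (S.rank σ))) fun c => M.pi.sem (a c.2) c.1) h1).trans ?_
    refine (congrArg (fun f => Term.substSum (B := M.piQ.angle (Fin (S.rank σ))) Term.atom f
      (M.pi.rhs q σ fun i => PiP.of M (a i))) h2).trans ?_
    cases q with
    | inl q => exact substSum_theta σ a q
    | inr y => exact hM.substSum_helperRhs σ a y

theorem Nondeleting.translation_pi (hM : M.Nondeleting) (s : Term S Empty) :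
    M.pi.translation s = M.translation s :=
  congrArg (fun t : Term D (Fin (M.Q.rank M.q₀)) =>
    t.bind fun j => (Fin.cast M.rank_q₀ j).elim0) (hM.sem_pi s (Sum.inl M.q₀))

end MTT

namespace MTT

open Term

variable {S D : RankedAlphabet.{u}} {M : MTT S D}

/-! ### Reachable state calls -/

/-- A set of state calls `⟨q, p⟩` that contains the initial ones, and with a call all those that
it makes. -/
structure Closed (M : MTT S D) (L : M.Q.Sym → M.P → Prop) : Prop where
  init : ∀ p, L M.q₀ p
  call : ∀ (q : M.Q.Sym) (σ : S.Sym) (p : Fin (S.rank σ) → M.P) (r : M.Q.Sym)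
    (i : Fin (S.rank σ)), L q (M.h σ p) →
      (M.rhs q σ p).Occurs (S := D.sum (M.Q.angle (Fin (S.rank σ)))) (Sum.inr (r, i)) → L r (p i)

theorem Closed.of_occurs {L : M.Q.Sym → M.P → Prop} (hL : M.Closed L)
    (s : Term (S.sum (RankedAlphabet.constants M.P)) Empty) (q : M.Q.Sym)
    (hq : L q (M.ext.look s)) {r : M.Q.Sym} {p : M.P}
    (h : (M.ext.sem s q).Occurs (S := D.sum (M.Q.angle M.P)) (Sum.inr (r, p))) : L r p := by
  induction s generalizing q with
  | var e => exact e.elim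
  | node σ a ih =>
    obtain ⟨c, hc, h⟩ := h.subst₂
    cases σ with
    | inl σ =>
      obtain ⟨b, hb, hc⟩ := hc.subst₂
      cases b with
      | inl d =>
        rcases hc with hc | ⟨_, hc⟩
        · cases hc
          rcases h with h | ⟨_, h⟩
          · cases h
          · exact h.elim
        · exact hc.elim
      | inr b =>
        rcases hc with hc | ⟨_, hc⟩
        · cases hc
          exact ih b.2 b.1 (hL.call q σ (fun i => M.ext.look (a i)) b.1 b.2 hq hb) h
        · exact hc.elim
    | inr p' =>
      rcases hc with hc | ⟨_, hc⟩
      · cases hc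
        rcases h with h | ⟨_, h⟩
        · cases h
          exact hq
        · exact h.elim
      · exact hc.elim

theorem Closed.of_reachable {L : M.Q.Sym → M.P → Prop} (hL : M.Closed L) {q : M.Q.Sym} {p : M.P}
    (h : M.Reachable q p) : L q p := by
  obtain ⟨s, h⟩ := h
  rcases h.bind with h | ⟨j, -⟩
  · exact hL.of_occurs s _ (hL.init _) h
  · exact (Fin.cast M.rank_q₀ j).elim0

/-- The calls that `π(M)` makes if those of `M` are in `L`: proper calls in `L`, and calls of
helper states for improper calls in `L`. -/
def LivePi (L : M.Q.Sym → M.P → Prop) : M.piQ.Sym → M.PiP → Prop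
  | Sum.inl q, x => L q x.1.1 ∧ q ∉ M.F₁ x.1.1
  | Sum.inr y, x => y.p = x.1.1 ∧ x.1.2 y.r = some y.t ∧ L y.r x.1.1

/-- The calls in an inlined right-hand side of a call in `L` are live for `π(M)`. -/
theorem Closed.livePi_of_theta {L : M.Q.Sym → M.P → Prop} (hL : M.Closed L) {q : M.Q.Sym}
    {σ : S.Sym} {x : Fin (S.rank σ) → M.PiP} (hq : L q (M.h σ fun i => (x i).1.1))
    {g : M.piQ.Sym} {i : Fin (S.rank σ)}
    (h : (M.theta q σ x).Occurs (S := D.sum (M.piQ.angle (Fin (S.rank σ)))) (Sum.inr (g, i))) :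
    LivePi L g (x i) := by
  obtain ⟨c, hc, h⟩ := h.subst₂
  cases c with
  | inl d =>
    rcases h with h | ⟨_, h⟩
    · cases h
    · exact h.elim
  | inr c =>
    obtain ⟨r, i'⟩ := c
    obtain ⟨rfl, ⟨rfl, hr⟩ | ⟨y, rfl, hp, rfl, ht⟩⟩ := occurs_thetaCall h
    · exact ⟨hL.call q σ _ r i hq hc, hr⟩
    · exact ⟨hp, ht, hL.call q σ _ _ i hq hc⟩

theorem not_occurs_dummy (y : M.Helper) {k : ℕ} {b : (M.piQ.angle (Fin k)).Sym} :
    ¬ (y.dummy k).Occurs (S := D.sum (M.piQ.angle (Fin k))) (Sum.inr b) := by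
  intro h
  obtain ⟨d, -, h⟩ := h.subst₂
  rcases h with h | ⟨_, h⟩
  · cases h
  · exact h.elim

theorem Closed.pi {L : M.Q.Sym → M.P → Prop} (hL : M.Closed L) (hM : M.Nondeleting) :
    M.pi.Closed (LivePi L) where
  init x := ⟨hL.init _, fun ⟨y, _⟩ => (Fin.cast M.rank_q₀ y).elim0⟩
  call g σ x r i hg h := by
    choose a ha using fun i => PiP.exists_of (x i)
    have hx : x = fun i => PiP.of M (a i) := funext ha
    subst hx
    have hp : M.pi.h σ (fun i => PiP.of M (a i)) = PiP.of M (.node σ a) := hM.piH_of σ a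
    rw [hp] at hg
    cases g with
    | inl q => exact hL.livePi_of_theta (x := fun i => PiP.of M (a i)) hg.1 h
    | inr y =>
      change (M.helperRhs y σ fun i => PiP.of M (a i)).Occurs
        (S := D.sum (M.piQ.angle (Fin (S.rank σ)))) (Sum.inr (r, i)) at h
      unfold helperRhs at h
      split at h
      · split at h
        · rename_i ξ hξ
          rw [Term.restrict] at h
          rcases h.bind with h | ⟨v, h⟩
          · exact hL.livePi_of_theta (x := fun i => PiP.of M (a i)) hg.2.2 (h.of_sub? hξ)
          · split at h
            · exact h.elim
            · exact absurd h (not_occurs_dummy y)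
        · exact absurd h (not_occurs_dummy y)
      · exact absurd h (not_occurs_dummy y)

end MTT

namespace Term

/-! ### Iterated pruning along a decreasing sequence of sets of inputs -/

section cut

open Filter

variable {X : Type u} {D : RankedAlphabet.{u}} {m : ℕ} (C : ℕ → Set X) (f : X → Term D (Fin m))

/-- The parameters of bounded depth in the subtrees at `w` of the trees `f s`, `s ∈ C k`. -/
def boundedAt (k : ℕ) (w : List ℕ) : Set (Fin m) :=
  {y | {t | ∃ s ∈ C k, ((f s).sub? w).map (lcop {y}) = some t}.Finite}

/-- At stage `k`, pruning the subtree of `f s` at `w` for the parameters of bounded depth cuts off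
the subtree at `u`. -/
def CutOff (k : ℕ) (w u : List ℕ) : Prop :=
  ∃ s ∈ C (k + 1), ∃ ξ A, (f s).sub? w = some ξ ∧
    (ξ.lcopF (boundedAt C f k w)).sub? u = some (var (Sum.inr A))

/-- The subtree at `w` is obtained from the one at `v` by repeatedly passing to subtrees that are
cut off at one of the stages `n, …, k - 1`. -/
inductive Cut (n : ℕ) (v : List ℕ) : ℕ → List ℕ → Prop
  | refl : Cut n v n v
  | keep {k w} : Cut n v k w → Cut n v (k + 1) w
  | step {k w u} : Cut n v k w → CutOff C f k w u → Cut n v (k + 1) (w ++ u)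

variable {C f} {n k l : ℕ} {v w z : List ℕ}

theorem Cut.le (h : Cut C f n v k w) : n ≤ k := by
  induction h with
  | refl => exact le_rfl
  | keep _ ih => exact ih.trans (Nat.le_succ _)
  | step _ _ ih => exact ih.trans (Nat.le_succ _)

theorem Cut.trans (h : Cut C f n v k w) (h' : Cut C f k w l z) : Cut C f n v l z := by
  induction h' with
  | refl => exact h
  | keep _ ih => exact ih.keep
  | step _ hu ih => exact ih.step hu

theorem Cut.of_le (h : n ≤ k) : Cut C f n v k v := by
  induction k, h using Nat.le_induction with
  | base => exact .refl
  | succ k _ ih => exact ih.keep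

theorem Cut.cases_head (h : Cut C f n v k w) :
    w = v ∨ ∃ j u, n ≤ j ∧ u ≠ [] ∧ CutOff C f j v u ∧ Cut C f (j + 1) (v ++ u) k w := by
  induction h with
  | refl => exact Or.inl rfl
  | keep _ ih =>
    exact ih.imp id fun ⟨j, u, hj, hu, hc, h⟩ => ⟨j, u, hj, hu, hc, h.keep⟩
  | @step k w u hk hc ih =>
    rcases ih with rfl | ⟨j, u', hj, hu', hc', h⟩
    · by_cases hu : u = []
      · subst hu
        exact Or.inl (List.append_nil w)
      · exact Or.inr ⟨k, u, hk.le, hu, hc, .refl⟩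
    · exact Or.inr ⟨j, u', hj, hu', hc', h.step hc⟩

theorem boundedAt_mono (hC : Antitone C) (w : List ℕ) : Monotone fun k => boundedAt C f k w := by
  intro k l hkl y hy
  refine Set.Finite.subset hy ?_
  rintro t ⟨s, hs, h⟩
  exact ⟨s, hC hkl hs, h⟩

/-- The sets of parameters of bounded depth increase with the stage, so they are stationary. -/
theorem exists_boundedAt_eq (hC : Antitone C) (w : List ℕ) :
    ∃ k₀, ∀ k ≥ k₀, boundedAt C f k w = boundedAt C f k₀ w := by
  obtain ⟨k₀, h⟩ := WellFoundedGT.monotone_chain_condition ⟨_, boundedAt_mono (f := f) hC w⟩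
  exact ⟨k₀, fun k hk => (h k hk).symm⟩

variable (hC : Antitone C)
  (hconst : ∀ k w, Cut C f 0 [] k w →
    ∃ t, ∀ s ∈ C (k + 1), ∃ ξ, (f s).sub? w = some ξ ∧ ξ.lcopF (boundedAt C f k w) = t)
  (hparas : ∀ k w, Cut C f 0 [] k w →
    ∃ A : Finset (Fin m), ∀ s ∈ C k, ∃ ξ, (f s).sub? w = some ξ ∧ ξ.paras = A)

include hC hconst in
/-- The parameters of bounded depth become stationary, so that only finitely many subtrees are
ever cut off from a given one. -/
theorem finite_cutOff (hv : Cut C f 0 [] n v) : {u | ∃ j ≥ n, CutOff C f j v u}.Finite := by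
  obtain ⟨k₀, hk₀⟩ := exists_boundedAt_eq (f := f) hC v
  have hfin : ∀ j ≥ n, {u | CutOff C f j v u}.Finite := by
    intro j hj
    obtain ⟨t, ht⟩ := hconst j v (hv.trans (.of_le hj))
    refine t.finite_paths.subset ?_
    rintro u ⟨s, hs, ξ, A, hξ, hu⟩
    obtain ⟨ξ', hξ', h⟩ := ht s hs
    rw [hξ] at hξ'
    cases hξ'
    rw [h] at hu
    simp [hu]
  refine ((Set.finite_Icc n (max n k₀)).biUnion fun j hj => hfin j hj.1).subset ?_
  rintro u ⟨j, hj, hu⟩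
  rcases le_total j (max n k₀) with h | h
  · exact Set.mem_biUnion (Set.mem_Icc.2 ⟨hj, h⟩) hu
  · refine Set.mem_biUnion (Set.mem_Icc.2 ⟨le_max_left n k₀, le_rfl⟩) ?_
    obtain ⟨s, hs, ξ, A, hξ, hu⟩ := hu
    refine ⟨s, hC (Nat.succ_le_succ h) hs, ξ, A, hξ, ?_⟩
    rw [hk₀ _ (le_max_right _ _), ← hk₀ j ((le_max_right _ _).trans h)]
    exact hu

include hC hconst hparas in
/-- A subtree that is cut off has fewer parameters, as those of bounded depth do not occur in it.
Hence, by induction on the number of parameters, only finitely many subtrees are obtained. -/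
theorem finite_cut {A : Finset (Fin m)} (hv : Cut C f 0 [] n v)
    (hA : ∀ s ∈ C n, ∃ ξ, (f s).sub? v = some ξ ∧ ξ.paras = A) :
    {w | ∃ k, Cut C f n v k w}.Finite := by
  induction hc : A.card using Nat.strong_induction_on generalizing A n v with
  | _ a ih =>
  classical
  -- The part below one cut, which is smaller by induction.
  have hchild : ∀ u, u ≠ [] → ∀ j ≥ n, CutOff C f j v u →
      {w | ∃ k, Cut C f (j + 1) (v ++ u) k w}.Finite := by
    intro u hu j hj hcut
    have hv' : Cut C f 0 [] (j + 1) (v ++ u) := (hv.trans (.of_le hj)).step hcut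
    obtain ⟨A', hA'⟩ := hparas _ _ hv'
    refine ih A'.card ?_ hv' hA' rfl
    obtain ⟨s, hs, ξ, A'', hξ, hleaf⟩ := hcut
    obtain ⟨ξ₁, h1, h2⟩ := hA s (hC (hj.trans (Nat.le_succ j)) hs)
    rw [hξ] at h1
    cases h1
    obtain ⟨ξ₂, h3, h4⟩ := hA' s hs
    rw [sub?_append, hξ, Option.bind_some] at h3
    obtain ⟨ξ₃, h5, h6, h7⟩ := sub?_of_sub?_lcopF hleaf
    rw [h3] at h5
    cases h5
    rw [h4] at h6
    rw [Finset.coe_inj] at h6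
    subst h6
    rw [← hc]
    refine Finset.card_lt_card ⟨?_, fun hle => ?_⟩
    · rw [← Finset.coe_subset, ← h4, ← h2]
      exact paras_sub?_subset h3
    · by_cases hF : (ξ.paras ∩ boundedAt C f j v).Nonempty
      · obtain ⟨y, hy, hyF⟩ := hF
        rw [h2] at hy
        exact Set.disjoint_left.1 h7 (hle hy) hyF
      · rw [lcopF_of_not hF] at hleaf
        cases u with
        | nil => exact hu rfl
        | cons i u => simp [sub?] at hleaf
  -- A cut at `u` may be made at many stages. What follows the first one covers the others, since a
  -- path may be kept from one stage to the next.
  refine ((Set.finite_singleton v).union ((finite_cutOff hC hconst hv).biUnion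
    (t := fun u => if h : u ≠ [] ∧ ∃ j ≥ n, CutOff C f j v u then
      {w | ∃ k, Cut C f (Nat.find h.2 + 1) (v ++ u) k w} else ∅) fun u hu => ?_)).subset ?_
  · by_cases h : u ≠ [] ∧ ∃ j ≥ n, CutOff C f j v u
    · rw [dif_pos h]
      exact hchild u h.1 _ (Nat.find_spec h.2).1 (Nat.find_spec h.2).2
    · rw [dif_neg h]
      exact Set.finite_empty
  · rintro w ⟨k, hw⟩
    rcases hw.cases_head with rfl | ⟨j, u, hj, hu, hcut, hw⟩
    · exact Or.inl rfl
    · have h : u ≠ [] ∧ ∃ j ≥ n, CutOff C f j v u := ⟨hu, j, hj, hcut⟩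
      refine Or.inr (Set.mem_biUnion (x := u) ⟨j, hj, hcut⟩ ?_)
      rw [dif_pos h]
      exact ⟨k, (Cut.of_le (Nat.succ_le_succ (Nat.find_min' h.2 ⟨hj, hcut⟩))).trans hw⟩

include hC hconst hparas in
/-- From some stage on, the pruned subtrees are the same for all inputs that are left. -/
theorem eventually_lcopF_eq : ∀ᶠ k in atTop, ∀ w, Cut C f 0 [] k w →
    ∃ t, ∀ s ∈ C k, ∃ ξ, (f s).sub? w = some ξ ∧ ξ.lcopF (boundedAt C f k w) = t := by
  obtain ⟨A, hA⟩ := hparas 0 [] .refl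
  have hfin := finite_cut hC hconst hparas .refl hA
  have key : ∀ w ∈ {w | ∃ k, Cut C f 0 [] k w}, ∀ᶠ k in atTop,
      ∃ t, ∀ s ∈ C k, ∃ ξ, (f s).sub? w = some ξ ∧ ξ.lcopF (boundedAt C f k w) = t := by
    rintro w ⟨j, hj⟩
    obtain ⟨k₀, hk₀⟩ := exists_boundedAt_eq (f := f) hC w
    refine eventually_atTop.2 ⟨max j k₀ + 1, fun k hk => ?_⟩
    obtain ⟨k, rfl⟩ := Nat.exists_eq_add_of_le' (Nat.one_le_of_lt hk)
    have hk' := Nat.le_of_succ_le_succ hk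
    rw [hk₀ (k + 1) ((le_max_right _ _).trans (hk'.trans (Nat.le_succ k))),
      ← hk₀ k ((le_max_right _ _).trans hk')]
    exact hconst k w (hj.trans (.of_le ((le_max_left _ _).trans hk')))
  filter_upwards [(eventually_all_finite hfin).2 key] with k hk w hw
  exact hk w ⟨k, hw⟩

end cut

end Term

namespace MTT

open Term Filter

variable {S D : RankedAlphabet.{u}} {M : MTT S D}

/-! ### Translations of states as subtrees -/

theorem Nondeleting.look_pi_eq_iff (hM : M.Nondeleting) {s : Term S Empty} {x : M.PiP} :
    M.pi.look s = x ↔ M.look s = x.1.1 ∧ M.phi x.1.1 s = x.1.2 := by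
  rw [hM.look_pi]
  obtain ⟨⟨p, φ⟩, hx⟩ := x
  constructor
  · intro h
    cases h
    exact ⟨rfl, rfl⟩
  · rintro ⟨h1, h2⟩
    dsimp only at h1 h2
    subst h1 h2
    rfl

theorem Nondeleting.lcopF_eq_of_phi_eq (hM : M.Nondeleting) {p : M.P} {s s' : Term S Empty}
    (h : M.phi p s = M.phi p s') (g : M.Q.Sym) :
    (M.sem s g).lcopF (M.F p g) = (M.sem s' g).lcopF (M.F p g) := by
  by_cases hg : g ∈ M.F₁ p
  · have := congrFun h g
    rwa [phi_of_mem hg, phi_of_mem hg, Option.some_inj] at this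
  · have hF : M.F p g = ∅ := Set.not_nonempty_iff_eq_empty.1 hg
    have hne : ∀ s, ¬ ((M.sem s g).paras ∩ M.F p g).Nonempty := by simp [hF]
    rw [lcopF_of_not (hne s), lcopF_of_not (hne s')]
    congr 2
    ext y
    simp [hM.paras_sem]

/-- For all inputs `s` in `C`, the translation by the state `g` is, up to an injective renaming of
the parameters, the subtree of `f s` at `w`. -/
def Describes (M : MTT S D) (g : M.Q.Sym) (C : Set (Term S Empty)) {m : ℕ}
    (f : Term S Empty → Term D (Fin m)) (w : List ℕ) : Prop :=
  ∃ ι : Fin (M.Q.rank g) → Fin m, Function.Injective ι ∧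
    ∀ s ∈ C, (f s).sub? w = some ((M.sem s g).map ι)

section describes

variable {C : ℕ → Set (Term S Empty)} {k m : ℕ} {f : Term S Empty → Term D (Fin m)} {w : List ℕ}
  {p : M.P} {g : M.Q.Sym} {ι : Fin (M.Q.rank g) → Fin m}

/-- The depth-bounded parameters of a state are those of the subtree that it describes. -/
theorem preimage_boundedAt (hι : Function.Injective ι) (hC : C k = {s | M.look s = p})
    (hg : ∀ s ∈ C k, (f s).sub? w = some ((M.sem s g).map ι)) :
    ι ⁻¹' boundedAt C f k w = M.F p g := by
  ext y
  have : {t | ∃ s ∈ C k, ((f s).sub? w).map (lcop {ι y}) = some t} =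
      Term.map (Option.map ι) '' M.pout g {y} p := by
    ext t
    constructor
    · rintro ⟨s, hs, h⟩
      rw [hg s hs, Option.map_some, lcop_map hι, Option.some_inj] at h
      rw [hC] at hs
      exact ⟨_, ⟨s, hs, rfl⟩, h⟩
    · rintro ⟨_, ⟨s, hs, rfl⟩, h⟩
      have hs' : s ∈ C k := by rwa [hC]
      refine ⟨s, hs', ?_⟩
      rw [hg s hs', Option.map_some, lcop_map hι, h]
  change Set.Finite _ ↔ Set.Finite _
  rw [this]
  exact Set.finite_image_iff (Term.map_injective (Option.map_injective hι)).injOn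

/-- Pruning a described subtree amounts to pruning the output of the state. -/
theorem lcopF_boundedAt (hι : Function.Injective ι) (hC : C k = {s | M.look s = p})
    (hg : ∀ s ∈ C k, (f s).sub? w = some ((M.sem s g).map ι)) (s : Term S Empty) :
    ((M.sem s g).map ι).lcopF (boundedAt C f k w) =
      ((M.sem s g).lcopF (M.F p g)).map (Sum.map ι (Finset.map ⟨ι, hι⟩)) := by
  rw [lcopF_map hι, preimage_boundedAt hι hC hg]

variable {x : M.PiP}

/-- The states of `M` keep their description on the smaller set of inputs. -/
theorem Describes.inl (hM : M.Nondeleting) (h : M.Describes g (C k) f w)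
    (hC : C (k + 1) ⊆ C k) : M.pi.Describes (Sum.inl g) (C (k + 1)) f w := by
  obtain ⟨ι, hι, h⟩ := h
  refine ⟨ι, hι, fun s hs => (h s (hC hs)).trans (congrArg some ?_)⟩
  exact congrArg (Term.map ι) (hM.sem_pi s (Sum.inl g)).symm

/-- The subtrees computed by the helper states for `g`. -/
theorem Describes.inr (hM : M.Nondeleting) (y : M.Helper) (h : M.Describes y.r (C k) f w)
    (hC : C k = {s | M.look s = x.1.1}) (hC' : C (k + 1) = {s | M.pi.look s = x})
    (hp : y.p = x.1.1) (ht : x.1.2 y.r = some y.t) :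
    M.pi.Describes (Sum.inr y) (C (k + 1)) f (w ++ y.u) ∧ CutOff C f k w y.u := by
  obtain ⟨ι, hι, h⟩ := h
  have hsem : ∀ s ∈ C (k + 1), s ∈ C k ∧ M.look s = y.p ∧
      M.phi (M.look s) s y.r = some y.t := by
    intro s hs
    rw [hC'] at hs
    obtain ⟨h1, h2⟩ := hM.look_pi_eq_iff.1 hs
    rw [hC]
    exact ⟨h1, h1.trans hp.symm, by rw [h1, h2, ht]⟩
  refine ⟨⟨ι ∘ y.A.orderEmbOfFin rfl, hι.comp (y.A.orderEmbOfFin rfl).injective, ?_⟩, ?_⟩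
  · intro s hs
    obtain ⟨h1, h2, h3⟩ := hsem s hs
    obtain ⟨ξ, hξ, hA, -⟩ := y.exists_sub? h3
    rw [sub?_append, h s h1, Option.bind_some, sub?_map, hξ, Option.map_some]
    refine congrArg some (Eq.trans ?_
      (congrArg (Term.map (ι ∘ y.A.orderEmbOfFin rfl)) (hM.sem_pi s (Sum.inr y))).symm)
    change _ = (y.sem s).map _
    rw [y.sem_of_pos h2 h3 hξ, ← Term.map_map, restrict_map hA.le]
  · obtain ⟨s, rfl⟩ := PiP.exists_of x
    have hs : s ∈ C (k + 1) := by
      rw [hC']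
      exact hM.look_pi s
    obtain ⟨h1, h2, h3⟩ := hsem s hs
    refine ⟨s, hs, _, y.A.map ⟨ι, hι⟩, h s h1, ?_⟩
    have hl : ((M.sem s y.r).lcopF (M.F (PiP.of M s).1.1 y.r)).sub? y.u =
        some (var (Sum.inr y.A)) := (phi_eq_some ht).2 ▸ y.leaf
    rw [lcopF_boundedAt hι hC h s, sub?_map]
    exact congrArg (Option.map (Term.map (Sum.map ι (Finset.map ⟨ι, hι⟩)))) hl

/-- Conversely, every subtree that is cut off is computed by some state of `π(M)`. -/
theorem Describes.exists_of_cutOff (hM : M.Nondeleting) (h : M.Describes g (C k) f w)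
    (hC : C k = {s | M.look s = x.1.1}) (hC' : C (k + 1) = {s | M.pi.look s = x}) {u : List ℕ}
    (hu : CutOff C f k w u) : ∃ g', M.pi.Describes g' (C (k + 1)) f (w ++ u) := by
  have hsub : C (k + 1) ⊆ C k := by
    rw [hC, hC']
    exact fun s hs => (hM.look_pi_eq_iff.1 hs).1
  have hd := h
  obtain ⟨ι, hι, h⟩ := h
  obtain ⟨s, hs, ξ, A, hξ, hu⟩ := hu
  rw [h s (hsub hs), Option.some_inj] at hξ
  subst hξ
  rw [lcopF_boundedAt hι hC h s] at hu
  -- If `g` is improper, the subtree is computed by a helper state. Otherwise pruning leaves a single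
  -- leaf, so that `u` is the root and `g` itself computes the subtree.
  by_cases hg : g ∈ M.F₁ x.1.1
  · rw [sub?_map, Option.map_eq_some_iff] at hu
    obtain ⟨ξ, hξ, hu⟩ := hu
    rw [hC'] at hs
    obtain ⟨h1, h2⟩ := hM.look_pi_eq_iff.1 hs
    cases ξ with
    | node => cases hu
    | var v =>
      cases v with
      | inl y => cases hu
      | inr A' =>
        let y : M.Helper := ⟨x.1.1, g, _, u, A', ⟨hg, s, h1, rfl⟩, hξ⟩
        refine ⟨Sum.inr y, (Describes.inr hM y hd hC hC' rfl ?_).1⟩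
        rw [← h2]
        exact phi_of_mem hg
  · have hne : ¬ ((M.sem s g).paras ∩ M.F x.1.1 g).Nonempty :=
      fun ⟨y, hy⟩ => hg ⟨y, hy.2⟩
    rw [lcopF_of_not hne] at hu
    cases u with
    | nil =>
      rw [List.append_nil]
      exact ⟨_, hd.inl hM hsub⟩
    | cons i u => simp [sub?] at hu

end describes

/-! ### The iteration -/

/-- The `k`-th iterate `π^k(M)`. -/
noncomputable def iter (M : MTT S D) : ℕ → MTT S D
  | 0 => M
  | k + 1 => (iter M k).pi

theorem iterate_pi (M : MTT S D) (k : ℕ) : MTT.pi^[k] M = M.iter k := by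
  induction k with
  | zero => rfl
  | succ k ih => rw [Function.iterate_succ_apply', ih, iter]

theorem Nondeleting.iter (hM : M.Nondeleting) (k : ℕ) : (M.iter k).Nondeleting := by
  induction k with
  | zero => exact hM
  | succ k ih => exact ih.pi

theorem Nondeleting.translation_iter (hM : M.Nondeleting) (k : ℕ) (s : Term S Empty) :
    (M.iter k).translation s = M.translation s := by
  induction k with
  | zero => rfl
  | succ k ih => exact ((hM.iter k).translation_pi s).trans ih

/-- The look-ahead state of `π^k(M)` from which a look-ahead state of `π^{k+1}(M)` is built. -/
def parent {k : ℕ} (x : (M.iter (k + 1)).P) : (M.iter k).P :=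
  (show (M.iter k).PiP from x).1.1

section branch

/-- The inputs with a given look-ahead state, for every look-ahead state of a branch. -/
def branchClass (p : ∀ k, (M.iter k).P) (k : ℕ) : Set (Term S Empty) :=
  {s | (M.iter k).look s = p k}

theorem branchClass_eq (p : ∀ k, (M.iter k).P) (hp : ∀ k, parent (p (k + 1)) = p k) (k : ℕ) :
    branchClass p k = {s | (M.iter k).look s = (show (M.iter k).PiP from p (k + 1)).1.1} := by
  have : (show (M.iter k).PiP from p (k + 1)).1.1 = p k := hp k
  rw [this]
  rfl

variable (hM : M.Nondeleting) (p : ∀ k, (M.iter k).P) (hp : ∀ k, parent (p (k + 1)) = p k)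

include hM hp

theorem branchClass_succ (k : ℕ) : branchClass p (k + 1) ⊆ branchClass p k :=
  fun _ hs => ((hM.iter k).look_pi_eq_iff.1 hs).1.trans (hp k)

theorem branchClass_nonempty (k : ℕ) : (branchClass p k).Nonempty := by
  obtain ⟨s, hs⟩ := PiP.exists_of (M := M.iter k) (p (k + 1))
  exact ⟨s, branchClass_succ hM p hp k (((hM.iter k).look_pi s).trans hs.symm)⟩

/-- Every path that is reached by cutting describes some state. -/
theorem exists_describes_of_cut {q : M.Q.Sym} {k : ℕ} {w : List ℕ}
    (h : Cut (branchClass p) (fun s => M.sem s q) 0 [] k w) :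
    ∃ g, (M.iter k).Describes g (branchClass p k) (fun s => M.sem s q) w := by
  induction h with
  | refl => exact ⟨q, id, Function.injective_id, fun s _ =>
      (Term.sub?_nil _).trans (congrArg some (bind_var _).symm)⟩
  | @keep k w _ ih =>
    obtain ⟨g, hg⟩ := ih
    exact ⟨_, hg.inl (hM.iter k) (branchClass_succ hM p hp k)⟩
  | @step k w u _ hu ih =>
    obtain ⟨g, hg⟩ := ih
    exact hg.exists_of_cutOff (hM.iter k) (branchClass_eq p hp k) rfl hu

/-- On the inputs that are left at stage `k` of a branch, every state of `π^k(M)` has a constant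
translation or computes a subtree that is reached by cutting. The first case arises from the dummy
rules of helper states which belong to other look-ahead states. -/
theorem const_or_describes (k : ℕ) (g : (M.iter k).Q.Sym) :
    (∃ c, ∀ s ∈ branchClass p k, (M.iter k).sem s g = c) ∨
      ∃ q w, Cut (branchClass p) (fun s => M.sem s q) 0 [] k w ∧
        (M.iter k).Describes g (branchClass p k) (fun s => M.sem s q) w := by
  induction k with
  | zero =>
    exact Or.inr ⟨g, [], .refl, id, Function.injective_id,
      fun s _ =>
      (Term.sub?_nil _).trans (congrArg some (bind_var _).symm)⟩
  | succ k ih =>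
    have hsub := branchClass_succ hM p hp k
    rcases g with g | y
    · rcases ih g with ⟨c, hc⟩ | ⟨q, w, hw, hd⟩
      · exact Or.inl ⟨c, fun s hs => ((hM.iter k).sem_pi s (Sum.inl g)).trans (hc s (hsub hs))⟩
      · exact Or.inr ⟨q, w, hw.keep, hd.inl (hM.iter k) hsub⟩
    · let x : (M.iter k).PiP := p (k + 1)
      by_cases hy : y.p = x.1.1 ∧ x.1.2 y.r = some y.t
      · rcases ih y.r with ⟨c, hc⟩ | ⟨q, w, hw, hd⟩
        · left
          obtain ⟨s₀, hs₀⟩ := branchClass_nonempty hM p hp (k + 1)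
          refine ⟨(M.iter (k + 1)).sem s₀ (Sum.inr y), fun s hs => ?_⟩
          refine ((hM.iter k).sem_pi s (Sum.inr y)).trans
            (Eq.trans ?_ ((hM.iter k).sem_pi s₀ (Sum.inr y)).symm)
          have key : ∀ s ∈ branchClass p (k + 1), (M.iter k).look s = y.p ∧
              (M.iter k).phi ((M.iter k).look s) s y.r = some y.t := by
            intro s hs
            obtain ⟨h1, h2⟩ := (hM.iter k).look_pi_eq_iff.1 hs
            exact ⟨h1.trans hy.1.symm, by rw [h1, h2]; exact hy.2⟩
          obtain ⟨h1, h2⟩ := key s hs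
          obtain ⟨h3, h4⟩ := key s₀ hs₀
          obtain ⟨ξ, hξ, -⟩ := y.exists_sub? h2
          have hξ₀ := hξ
          rw [hc s (hsub hs), ← hc s₀ (hsub hs₀)] at hξ₀
          exact (y.sem_of_pos h1 h2 hξ).trans (y.sem_of_pos h3 h4 hξ₀).symm
        · have := Describes.inr (x := x) (hM.iter k) y hd (branchClass_eq p hp k) rfl hy.1 hy.2
          exact Or.inr ⟨q, _, hw.step this.2, this.1⟩
      · refine Or.inl ⟨y.exists_dummy.choose, fun s hs => ?_⟩
        refine ((hM.iter k).sem_pi s (Sum.inr y)).trans (y.sem_of_neg fun h => hy ?_)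
        obtain ⟨h1, h2⟩ := (hM.iter k).look_pi_eq_iff.1 hs
        rw [h1, h2] at h
        exact ⟨h.1.symm, h.2⟩

/-- Along a branch, the pruned outputs of all states become constant on the inputs that are
left. -/
theorem eventually_phi_eq : ∀ᶠ k in atTop, ∀ s ∈ branchClass p k, ∀ s' ∈ branchClass p k,
    (M.iter k).phi (p k) s = (M.iter k).phi (p k) s' := by
  have hanti : Antitone (branchClass p) := antitone_nat_of_succ_le (branchClass_succ hM p hp)
  have key : ∀ q : M.Q.Sym, ∀ᶠ k in atTop, ∀ w,
      Cut (branchClass p) (fun s => M.sem s q) 0 [] k w → ∃ t, ∀ s ∈ branchClass p k, ∃ ξ,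
        (M.sem s q).sub? w = some ξ ∧
          ξ.lcopF (boundedAt (branchClass p) (fun s => M.sem s q) k w) = t := by
    intro q
    refine eventually_lcopF_eq hanti ?_ ?_
    · intro k w hw
      obtain ⟨g, ι, hι, hg⟩ := exists_describes_of_cut hM p hp hw
      obtain ⟨s₀, hs₀⟩ := branchClass_nonempty hM p hp (k + 1)
      refine ⟨(((M.iter k).sem s₀ g).lcopF ((M.iter k).F (p k) g)).map
          (Sum.map ι (Finset.map ⟨ι, hι⟩)), fun s hs => ⟨_,
        hg s (branchClass_succ hM p hp k hs), (lcopF_boundedAt hι rfl hg s).trans ?_⟩⟩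
      have h1 := ((hM.iter k).look_pi_eq_iff.1 hs).2
      have h2 := ((hM.iter k).look_pi_eq_iff.1 hs₀).2
      have h3 := h1.trans h2.symm
      have h4 : (show (M.iter k).PiP from p (k + 1)).1.1 = p k := hp k
      rw [h4] at h3
      rw [(hM.iter k).lcopF_eq_of_phi_eq h3]
    · intro k w hw
      obtain ⟨g, ι, hι, hg⟩ := exists_describes_of_cut hM p hp hw
      refine ⟨Finset.univ.map ⟨ι, hι⟩, fun s hs => ⟨_, hg s hs, ?_⟩⟩
      rw [paras_map, (hM.iter k).paras_sem]
      simp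
  filter_upwards [eventually_all.2 key] with k hk s hs s' hs'
  funext g
  by_cases hg : g ∈ (M.iter k).F₁ (p k)
  · rw [phi_of_mem hg, phi_of_mem hg]
    rcases const_or_describes hM p hp k g with ⟨c, hc⟩ | ⟨q, w, hw, ι, hι, hd⟩
    · rw [hc s hs, hc s' hs']
    · obtain ⟨t, ht⟩ := hk q w hw
      obtain ⟨ξ, h1, h2⟩ := ht s hs
      obtain ⟨ξ', h1', h2'⟩ := ht s' hs'
      rw [hd s hs, Option.some_inj] at h1
      rw [hd s' hs', Option.some_inj] at h1'
      subst h1 h1'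
      have h := h2.trans h2'.symm
      rw [lcopF_boundedAt hι rfl hd, lcopF_boundedAt hι rfl hd] at h
      exact congrArg some (Term.map_injective
        (Sum.map_injective.2 ⟨hι, Finset.map_injective _⟩) h)
  · rw [phi_of_not_mem hg, phi_of_not_mem hg]

/-- A branch eventually does not ramify any more. -/
theorem eventually_eq_of_parent_eq : ∀ᶠ k in atTop,
    (∀ x : (M.iter (k + 1)).P, parent x = p k → x = p (k + 1)) ∧
      branchClass p k ⊆ branchClass p (k + 1) := by
  filter_upwards [eventually_phi_eq hM p hp] with k hk
  -- All inputs that are left have the same `φ`, hence the same look-ahead state at the next stage.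
  have hsucc : branchClass p k ⊆ branchClass p (k + 1) := by
    intro s hs
    obtain ⟨s₀, hs₀⟩ := branchClass_nonempty hM p hp (k + 1)
    obtain ⟨h1, h2⟩ := (hM.iter k).look_pi_eq_iff.1 hs₀
    have h4 : (show (M.iter k).PiP from p (k + 1)).1.1 = p k := hp k
    refine (hM.iter k).look_pi_eq_iff.2 ⟨?_, ?_⟩
    · exact Eq.trans hs h4.symm
    · refine Eq.trans ?_ h2
      have := hk s hs s₀ (branchClass_succ hM p hp k hs₀)
      rwa [← h4] at this
  refine ⟨fun x hx => ?_, hsucc⟩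
  obtain ⟨s, hs⟩ := PiP.exists_of (M := M.iter k) x
  have h1 : (M.iter (k + 1)).look s = x := ((hM.iter k).look_pi s).trans hs.symm
  rw [← h1]
  exact hsucc (((hM.iter k).look_pi_eq_iff.1 h1).1.trans hx)

end branch

/-! ### Termination -/

/-- A set of state calls of `π^k(M)` that contains all reachable ones. -/
def Live (M : MTT S D) : ∀ k, (M.iter k).Q.Sym → (M.iter k).P → Prop
  | 0 => fun _ _ => True
  | k + 1 => LivePi (Live M k)

theorem Nondeleting.closed_live (hM : M.Nondeleting) (k : ℕ) : (M.iter k).Closed (M.Live k) := by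
  induction k with
  | zero => exact ⟨fun _ => trivial, fun _ _ _ _ _ _ _ => trivial⟩
  | succ k ih => exact ih.pi (hM.iter k)

/-- Some live state call with the look-ahead state `p` is improper. -/
def Improper (M : MTT S D) (k : ℕ) (p : (M.iter k).P) : Prop :=
  ∃ g ∈ (M.iter k).F₁ p, M.Live k g p

theorem Nondeleting.depthProper_iter (hM : M.Nondeleting) {k : ℕ} (h : ∀ p, ¬ M.Improper k p) :
    (M.iter k).DepthProper :=
  fun q p hr y hy => h p ⟨q, ⟨y, hy⟩, (hM.closed_live k).of_reachable hr⟩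

/-- The look-ahead state `p'` of `π^n(M)` refines the look-ahead state `p` of `π^k(M)`. -/
inductive Refines {k : ℕ} (p : (M.iter k).P) : ∀ n, (M.iter n).P → Prop
  | refl : Refines p k p
  | child {n} (x : (M.iter (n + 1)).P) : Refines p n (parent x) → Refines p (n + 1) x

theorem Refines.le {k n : ℕ} {p : (M.iter k).P} {p' : (M.iter n).P} (h : Refines p n p') :
    k ≤ n := by
  induction h with
  | refl => exact le_rfl
  | child _ _ ih => exact ih.trans (Nat.le_succ _)

theorem Refines.eq {k : ℕ} {p p' : (M.iter k).P} (h : Refines p k p') : p' = p := by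
  cases h with
  | refl => rfl
  | child x hx => exact absurd hx.le (Nat.not_succ_le_self _)

theorem Refines.cases_head {k n : ℕ} {p : (M.iter k).P} {p' : (M.iter n).P}
    (h : Refines p n p') : n = k ∨ ∃ x : (M.iter (k + 1)).P, parent x = p ∧ Refines x n p' := by
  induction h with
  | refl => exact Or.inl rfl
  | @child n x hx ih =>
    right
    rcases ih with rfl | ⟨x', hx', h⟩
    · exact ⟨x, hx.eq, .refl⟩
    · exact ⟨x', hx', h.child x⟩

theorem exists_refines_zero (n : ℕ) (p' : (M.iter n).P) :
    ∃ p : (M.iter 0).P, Refines p n p' := by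
  induction n with
  | zero => exact ⟨p', .refl⟩
  | succ n ih =>
    obtain ⟨p, hp⟩ := ih (parent p')
    exact ⟨p, .child _ hp⟩

/-- No refinement of `p` has live improper calls from some stage on. -/
def EventuallyProper {k : ℕ} (p : (M.iter k).P) : Prop :=
  ∀ᶠ n in atTop, ∀ p' : (M.iter n).P, Refines p n p' → ¬ M.Improper n p'

theorem EventuallyProper.of_children {k : ℕ} {p : (M.iter k).P}
    (h : ∀ x : (M.iter (k + 1)).P, parent x = p → EventuallyProper x) : EventuallyProper p := by
  have h' : ∀ x : (M.iter (k + 1)).P, ∀ᶠ n in atTop, ∀ p' : (M.iter n).P,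
      parent x = p → Refines x n p' → ¬ M.Improper n p' := by
    intro x
    by_cases hx : parent x = p
    · filter_upwards [h x hx] with n hn p' _ using hn p'
    · exact Eventually.of_forall fun n p' hx' => absurd hx' hx
  filter_upwards [eventually_all.2 h', eventually_gt_atTop k] with n hn hk p' hp'
  rcases hp'.cases_head with rfl | ⟨x, hx, hp'⟩
  · exact absurd hk (lt_irrefl _)
  · exact hn x p' hx hp'

/-- Once a branch does not ramify, proper calls stay proper, and improper ones are replaced by
calls of helper states, of smaller rank. So the ranks of the live improper calls decrease. -/
theorem Nondeleting.eventuallyProper_of_branch (hM : M.Nondeleting) {p : ∀ k, (M.iter k).P}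
    {K : ℕ} (hK : ∀ k ≥ K, (∀ x : (M.iter (k + 1)).P, parent x = p k → x = p (k + 1)) ∧
      branchClass p k ⊆ branchClass p (k + 1)) (hp : ∀ k, parent (p (k + 1)) = p k) :
    EventuallyProper (p K) := by
  have huniq : ∀ n (p' : (M.iter n).P), Refines (p K) n p' → K ≤ n ∧ p' = p n := by
    intro n p' h
    induction h with
    | refl => exact ⟨le_rfl, rfl⟩
    | @child n x _ ih => exact ⟨ih.1.trans (Nat.le_succ n), (hK n ih.1).1 x ih.2⟩
  obtain ⟨R, hR⟩ := (Set.finite_range (M.iter K).Q.rank).bddAbove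
  have hrank : ∀ j, ∀ g ∈ (M.iter (K + j)).F₁ (p (K + j)), M.Live (K + j) g (p (K + j)) →
      (M.iter (K + j)).Q.rank g + j ≤ R := by
    intro j
    induction j with
    | zero => exact fun g _ _ => hR ⟨g, rfl⟩
    | succ j ih =>
      intro g hg hl
      have hN := hM.iter (K + j)
      let x : (M.iter (K + j)).PiP := p (K + j + 1)
      have hx : x.1.1 = p (K + j) := hp (K + j)
      rcases g with q | y
      · -- As the class of inputs is the same as before, the call would have been improper already.
        obtain ⟨y, hy⟩ := hg
        refine absurd ?_ hl.2
        refine ⟨y, ?_⟩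
        obtain ⟨n, hn⟩ := mem_F_iff.1 hy
        refine mem_F_iff.2 ⟨n, fun s hs => ?_⟩
        have hs' := hn s ((hK (K + j) (Nat.le_add_right K j)).2 (Eq.trans hs hx))
        refine le_trans (le_of_eq ?_) hs'
        exact congrArg (fun t => (Term.lcop {y} t).height) (hN.sem_pi s (Sum.inl q)).symm
      · -- The parameters of a helper state for `r` exclude the depth-bounded ones of `r`.
        obtain ⟨-, ht, hl⟩ := hl
        obtain ⟨s, hs⟩ := PiP.exists_of x
        have ht' : x.1.2 y.r = some y.t := ht
        have hl' : M.Live (K + j) y.r x.1.1 := hl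
        rw [hx] at hl'
        have hx' : (M.iter (K + j)).look s = p (K + j) := by rw [← hx, hs]; rfl
        rw [hs] at ht'
        have hr := (phi_eq_some ht').1
        have hlt := ih y.r (by rwa [← hx']) hl'
        obtain ⟨ξ, -, -, hd⟩ := y.exists_sub? ht'
        have hcard : y.A.card < (M.iter (K + j)).Q.rank y.r := by
          obtain ⟨z, hz⟩ := hr
          have : y.A ⊂ Finset.univ :=
            Finset.ssubset_univ_iff.2 fun h => Set.disjoint_left.1 hd (by simp [h]) hz
          simpa using Finset.card_lt_card this
        change y.A.card + (j + 1) ≤ R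
        omega
  refine eventually_atTop.2 ⟨K + (R + 1), fun n hn p' hp' => ?_⟩
  obtain ⟨j, rfl⟩ := Nat.exists_eq_add_of_le ((Nat.le_add_right _ _).trans hn)
  rw [(huniq _ _ hp').2]
  rintro ⟨g, hg, hl⟩
  have := hrank j g hg hl
  omega

/-- By König's lemma: otherwise there would be an infinite branch of look-ahead states that are
not eventually proper. -/
theorem Nondeleting.eventuallyProper (hM : M.Nondeleting) (p₀ : (M.iter 0).P) :
    EventuallyProper p₀ := by
  by_contra h₀
  have hnext : ∀ k (p : {p : (M.iter k).P // ¬ EventuallyProper p}),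
      ∃ x : {x : (M.iter (k + 1)).P // ¬ EventuallyProper x}, parent x.1 = p.1 := by
    intro k p
    by_contra h
    refine p.2 (.of_children fun x hx => ?_)
    by_contra hx'
    exact h ⟨⟨x, hx'⟩, hx⟩
  choose next hnext using hnext
  let p : ∀ k, {p : (M.iter k).P // ¬ EventuallyProper p} :=
    fun k => Nat.rec ⟨p₀, h₀⟩ (fun k p => next k p) k
  have hp : ∀ k, parent (p (k + 1)).1 = (p k).1 := fun k => hnext k (p k)
  obtain ⟨K, hK⟩ := eventually_atTop.1 (eventually_eq_of_parent_eq hM (fun k => (p k).1) hp)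
  exact (p K).2 (hM.eventuallyProper_of_branch hK hp)

end MTT

theorem mainTheorem5 {S D : RankedAlphabet.{u}} (M : MTT S D) (hM : M.Nondeleting) :
    (∀ (q : M.Q.Sym) (s : Term S Empty), M.pi.sem s (Sum.inl q) = M.sem s q) ∧
    M.pi.Nondeleting ∧
    (∀ (n : ℕ) (s : Term S Empty), (MTT.pi^[n] M).translation s = M.translation s) ∧
    ∃ N : ℕ, ∀ n ≥ N, (MTT.pi^[n] M).DepthProper := by
  refine ⟨fun q s => hM.sem_pi s (Sum.inl q), hM.pi, fun n s => ?_, ?_⟩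
  · rw [MTT.iterate_pi]
    exact hM.translation_iter n s
  · obtain ⟨N, hN⟩ := Filter.eventually_atTop.1
      (Filter.eventually_all.2 fun p₀ : (M.iter 0).P => hM.eventuallyProper p₀)
    refine ⟨N, fun n hn => ?_⟩
    rw [MTT.iterate_pi]
    refine hM.depthProper_iter fun p => ?_
    obtain ⟨p₀, hp₀⟩ := MTT.exists_refines_zero n p
    exact hN n hn p₀ p hp₀
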